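/- **Theorem.** *Setting.* Let $n\ge 0$ and $\sigma\in S_n$. A cell in row $r$ and column $c$ of a partition diagram has diagonal $c-r$ (row $0$ is the longest row). The Weyl group $S_{\pm\infty}$ of type $A_{\pm\infty}$, with generators $s_j$ ($j\in\mathbb Z$), acts on partitions: $s_j$ adds the addable cell of diagonal $j$, or removes the removable one, if there is one. The Weyl group $W_\infty$ of type $C_\infty$ (the limit of $C_N^{(1)}$ for $N\to\infty$), with generators $s_i$ ($i\ge 0$), embeds in $S_{\pm\infty}$ by $s_0\mapsto s_0$ and $s_i\mapsto s_is_{-i}$ ($i>0$). Let $W_\infty^0$ be the set of minimal length representatives of the cosets of $\langle s_i: i\ge1\rangle$ in $W_\infty$; the map $w\mapsto w\cdot\varnothing$ identifies it with the set $\mathbb Y^0=W_\infty\cdot\varnothing$ of transpose-symmetric partitions. On $\mathbb Y^0$ consider the covers of the strong (Bruhat) order and of the left weak order of $W_\infty^0$. A marking of a strong cover $\lambda\lessdot\mu$ is a $\lambda$-addable cell that lies in $\mu$. A folded strong tableau $P$ (folded weak tableau $Q$) with $n$ steps is a chain of $n$ marked strong covers (of $n$ weak covers) that starts at $\varnothing$.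 *Folded insertion* (folded LLMS insertion for $C_N^{(1)}$ with $i'=0$, in the limit $N\to\infty$). The growth diagram of $\sigma$ consists of partitions $G_{ij}\in\mathbb Y^0$ ($0\le i,j\le n$, matrix-style indices) with $G_{i0}=G_{0j}=\varnothing$. Each horizontal step $G_{i,j-1},G_{ij}$ is an equality or a marked strong cover; each vertical step $G_{i-1,j},G_{ij}$ is an equality or a weak cover. For $(z,y,x,w)=(G_{i-1,j-1},G_{i-1,j},G_{i,j-1},G_{ij})$, with marking $m$ on $z\to y$ and $M$ on $x\to w$, the rules are as follows. 1. If $z=x=y$ and $\sigma(i)\ne j$, then $w=z$. 2. If $z=x=y$ and $\sigma(i)=j$, then $x\to w$ is both a strong and a weak cover, and $M$ is the $x$-addable cell in the first row. 3. If $z\ne x=y$, then $x\to w$ is both a strong and a weak cover, and $M$ is the $x$-addable cell nearest to $m$ among those with higher row index than $m$. 4. If $z=y\ne x$, then $w=x$. If $z=x\ne y$, then $w=y$ and $M=m$. 5. If $x,y,z$ are distinct and $x=s_iz$ with $s_i\in W_\infty$, then $w=s_iy$ and $x\cup\{M\}=s_i(z\cup\{m\})$. Folded insertion sends $\sigma$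 to $(P,Q)$, where $P$ is the bottom row $G_{n\bullet}$ with its markings and $Q$ is the last column $G_{\bullet n}$. *Shifted tableaux.* $Q^*$ is the shifted tableau of the cells $(r,c)$, $r\le c$, of the final shape of $Q$, each filled with the number of the step that adds it. $P^*$ is obtained from $P$ in the same way, and moreover an entry $k$ in a cell $(r,c)$ with $r<c$ is marked if the marked cell of the $k$-th cover of $P$ is $(c,r)$, the one of negative diagonal. *Sagan–Worley insertion* of a permutation $\tau$ inserts the letters $\tau(1),\dots,\tau(n)$ one after the other into a shifted tableau. A letter is row inserted into the first row, where it replaces the leftmost greater entry or is placed at the end of the row. A replaced entry off the main diagonal is row inserted into the next row. When an entry on the main diagonal, in column $c$, is replaced, it is column inserted into column $c+1$, and from then on each replaced entry is column inserted into the next column. The image of $\tau$ is the final tableau together with the recording tableau, in which the cell created in step $k$ has the entry $k$, marked if step $k$ ended with a column insertion. *Claim.* Folded insertion sends $\sigma$ to a well-defined pair $(P,Q)$, and $(Q^*,P^*)$ is the image of $\sigma^{-1}$ under Sagan–Worley shifted insertion. -/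

import Mathlib

/-!
Partitions are Mathlib's `YoungDiagram`s. A cell `(r, c)` lies in row `r` and column `c`, both
counted from `0`, row `0` being the longest row; its diagonal is `c - r`.
-/

namespace FoldedInsertion

/-! ### The Weyl group `W_∞` of type `C_∞` and its action on partitions -/

/-- The border of a diagram, read from the vertical axis to the horizontal axis, is a bi-infinite
word in south steps and east steps, indexed by `ℤ` so that the two steps touching the cell of
diagonal `d` at a corner have indices `d - 1` and `d`. This is the set of indices of the south
steps (the remaining indices are those of the east steps); row `r` ends in the south step of index
`rowLen r - r - 1`. -/
def southSteps (lam : YoungDiagram) : Set ℤ :=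
  Set.range fun r : ℕ => (lam.rowLen r : ℤ) - r - 1

/-- `mu = g · lam`, where a permutation `g` of `ℤ` acts on partitions by permuting the letters of
the border word. -/
def Acts (g : Equiv.Perm ℤ) (lam mu : YoungDiagram) : Prop :=
  southSteps mu = g '' southSteps lam

/-- The simple reflection `s_j` (`j ∈ ℤ`) of the Weyl group `S_{±∞}` of `A_{±∞}`, realized by
finitary permutations of `ℤ`. It adds the addable cell of diagonal `j`, or removes the removable
one, if there is such a cell. -/
def simpleA (j : ℤ) : Equiv.Perm ℤ := Equiv.swap (j - 1) j

/-- The simple reflections of the Weyl group `W_∞` of `C_∞`, folded into `S_{±∞}`: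
`s_0 ↦ s_0`, and `s_i ↦ s_i s_{-i}` for `i > 0`. -/
def simpleC (i : ℕ) : Equiv.Perm ℤ :=
  if i = 0 then simpleA 0 else simpleA i * simpleA (-i)

/-- The Weyl group `W_∞` of `C_∞`, as a subgroup of the permutations of `ℤ`. -/
def weylC : Subgroup (Equiv.Perm ℤ) := Subgroup.closure (Set.range simpleC)

/-- The parabolic subgroup of `W_∞` generated by all simple reflections but `s_0`. -/
def parabolicC : Subgroup (Equiv.Perm ℤ) := Subgroup.closure (simpleC '' {i | i ≠ 0})

/-- The length function of `W_∞`: the least length of an expression as a product of simple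
reflections (used for elements of `weylC` only). -/
noncomputable def lengthC (w : Equiv.Perm ℤ) : ℕ :=
  sInf {k | ∃ l : List ℕ, l.length = k ∧ (l.map simpleC).prod = w}

/-- The set `W_∞^0` of minimal length representatives of the cosets of `parabolicC`. -/
def minRepsC : Set (Equiv.Perm ℤ) :=
  {w | w ∈ weylC ∧ ∀ y ∈ parabolicC, lengthC w ≤ lengthC (w * y)}

/-- The reflections of `W_∞`: conjugates of the simple reflections. -/
def IsReflectionC (t : Equiv.Perm ℤ) : Prop :=
  ∃ u ∈ weylC, ∃ i : ℕ, t = u * simpleC i * u⁻¹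

/-! ### The folded strong and weak graphs

The vertex `w` of `W_∞^0` is represented by the partition `w · ∅`. -/

/-- Cover relation of the left weak order on `W_∞^0`. These are the edges of the folded weak graph;
they have multiplicity one. -/
def WeakCover (lam mu : YoungDiagram) : Prop :=
  ∃ w : Equiv.Perm ℤ, ∃ i : ℕ, w ∈ minRepsC ∧ simpleC i * w ∈ minRepsC ∧
    lengthC (simpleC i * w) = lengthC w + 1 ∧ Acts w ⊥ lam ∧ Acts (simpleC i * w) ⊥ mu

/-- Cover relation of the strong (Bruhat) order on `W_∞^0`. -/
def StrongCover (lam mu : YoungDiagram) : Prop :=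
  ∃ w t : Equiv.Perm ℤ, IsReflectionC t ∧ w ∈ minRepsC ∧ w * t ∈ minRepsC ∧
    lengthC (w * t) = lengthC w + 1 ∧ Acts w ⊥ lam ∧ Acts (w * t) ⊥ mu

/-- `nu` is obtained from `lam` by adding the single cell `c`. -/
def AddCell (lam : YoungDiagram) (c : ℕ × ℕ) (nu : YoungDiagram) : Prop :=
  c ∉ lam ∧ nu.cells = insert c lam.cells

/-- The cell `c` is `lam`-addable. -/
def IsAddable (lam : YoungDiagram) (c : ℕ × ℕ) : Prop :=
  ∃ nu : YoungDiagram, AddCell lam c nu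

/-- The marked edges of the folded strong graph. A marking of a strong cover from `lam` to `mu` is
an edge of the unfolded strong graph (which for `A_{±∞}` is Young's lattice) that goes out of `lam`
and stays inside the interval from `lam` to `mu`; it is recorded by the cell `m` it adds. -/
def MarkedStrongEdge (lam mu : YoungDiagram) (m : ℕ × ℕ) : Prop :=
  StrongCover lam mu ∧ IsAddable lam m ∧ m ∈ mu

/-- A folded strong tableau with `n` steps: a path of `n` marked edges of the folded strong graph
that starts at the empty partition. -/
@[ext]
structure StrongTableau (n : ℕ) where
  shape : Fin (n + 1) → YoungDiagram
  mark : Fin n → ℕ × ℕ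
  start : shape 0 = ⊥
  edge : ∀ k : Fin n, MarkedStrongEdge (shape k.castSucc) (shape k.succ) (mark k)

/-- A folded weak tableau with `n` steps: a path of `n` edges of the folded weak graph that starts
at the empty partition. -/
@[ext]
structure WeakTableau (n : ℕ) where
  shape : Fin (n + 1) → YoungDiagram
  start : shape 0 = ⊥
  edge : ∀ k : Fin n, WeakCover (shape k.castSucc) (shape k.succ)

/-! ### Folded insertion through growth diagrams -/

/-- `(w, M)` is the path that goes up from `lam` to `w` by a strong edge with marking `M` and comes
back down by a weak edge, and that is identified with the `lam`-addable cell `M`. -/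
def UpDown (lam w : YoungDiagram) (M : ℕ × ℕ) : Prop :=
  MarkedStrongEdge lam w M ∧ WeakCover lam w

/-- `M` is the `lam`-addable cell in the first row. -/
def IsFirstRowAddable (lam : YoungDiagram) (M : ℕ × ℕ) : Prop :=
  IsAddable lam M ∧ M.1 = 0

/-- `M` is the `lam`-addable cell nearest to the cell `m` among those with higher row index. -/
def IsNextAddable (lam : YoungDiagram) (m M : ℕ × ℕ) : Prop :=
  IsAddable lam M ∧ m.1 < M.1 ∧ ∀ c : ℕ × ℕ, IsAddable lam c → m.1 < c.1 → M.1 ≤ c.1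

/-- The off-diagonal part of the differential bijection. If `x = s_i z`, the marked strong edge from
`z` to `y` is carried by `s_i` to the marked strong edge from `x = s_i z` to `w = s_i y`; the same
holds for the edge of Young's lattice, from `z` to `z ∪ {m}`, that the marking `m` stands for. -/
def OffDiagonal (z y x w : YoungDiagram) (m M : ℕ × ℕ) : Prop :=
  ∃ i : ℕ, Acts (simpleC i) z x ∧ Acts (simpleC i) y w ∧
    ∃ zm xM : YoungDiagram, AddCell z m zm ∧ AddCell x M xM ∧ Acts (simpleC i) zm xM

/-- The local rule for the unit square
```
  z --m--> y
  |        |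
  x --M--> w
```
with horizontal strong edges and vertical weak edges, where `c` says that the entry of the
permutation matrix in the square is nonzero. The marking of a degenerate edge is immaterial. -/
def LocalRule (c : Prop) (z y x w : YoungDiagram) (m M : ℕ × ℕ) : Prop :=
  (z = x → z = y → ¬ c → w = z) ∧
  (z = x → z = y → c → UpDown x w M ∧ IsFirstRowAddable x M) ∧
  (z ≠ x → x = y → UpDown x w M ∧ IsNextAddable x m M) ∧
  (z = y → z ≠ x → w = x) ∧
  (z = x → z ≠ y → w = y ∧ M = m) ∧
  (z ≠ x → z ≠ y → x ≠ y → OffDiagonal z y x w m M)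

/-- `G` and `H` form the growth diagram of the permutation `σ`, whose matrix has its nonzero entries
in the positions `(i, σ i)`. Rows of `G` are numbered from top to bottom, and `H i j` is the marking
of the `j`-th horizontal edge in the row of index `i`. -/
def IsGrowth {n : ℕ} (σ : Equiv.Perm (Fin n)) (G : Fin (n + 1) → Fin (n + 1) → YoungDiagram)
    (H : Fin (n + 1) → Fin n → ℕ × ℕ) : Prop :=
  (∀ j, G 0 j = ⊥) ∧ (∀ i, G i 0 = ⊥) ∧
  ∀ i j : Fin n, LocalRule (σ i = j)
    (G i.castSucc j.castSucc) (G i.castSucc j.succ) (G i.succ j.castSucc) (G i.succ j.succ)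
    (H i.castSucc j) (H i.succ j)

/-- `σ` maps to `(P, Q)` under folded insertion: `P` is the south edge and `Q` the east edge of the
growth diagram of `σ`. -/
def Maps {n : ℕ} (σ : Equiv.Perm (Fin n)) (P : StrongTableau n) (Q : WeakTableau n) : Prop :=
  ∃ G H, IsGrowth σ G H ∧
    (∀ j, P.shape j = G (Fin.last n) j) ∧ (∀ j, P.mark j = H (Fin.last n) j) ∧
    ∀ i, Q.shape i = G i (Fin.last n)

/-! ### Shifted tableaux and Sagan-Worley insertion

Cell `(r, c)` of a shifted diagram, with `r ≤ c`, lies in row `r` and column `c`; row `r` starts on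
the main diagonal, in column `r`. -/

/-- A filling of cells; `none` means that the cell is not in the diagram. -/
abbrev Filling (α : Type) : Type := ℕ × ℕ → Option α

open Classical in
/-- The shifted tableau `Q*`: the part of `Q` on or to one side of the main diagonal, where a cell
holds the number of the step that adds it. -/
noncomputable def WeakTableau.star {n : ℕ} (Q : WeakTableau n) : Filling ℕ := fun d =>
  if d.1 ≤ d.2 ∧ d ∈ Q.shape (Fin.last n) then
    some (sInf {k | ∃ i : Fin (n + 1), (i : ℕ) = k ∧ d ∈ Q.shape i})
  else none

open Classical in
/-- The shifted tableau `P*`, with the entry `(k, b)` in a cell added in step `k`; it is marked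
(`b = true`) if in this step the transposed cell, of negative diagonal, is the marked one. -/
noncomputable def StrongTableau.star {n : ℕ} (P : StrongTableau n) : Filling (ℕ × Bool) := fun d =>
  if d.1 ≤ d.2 ∧ d ∈ P.shape (Fin.last n) then
    let k := sInf {k | ∃ i : Fin (n + 1), (i : ℕ) = k ∧ d ∈ P.shape i}
    some (k, decide (d.1 < d.2 ∧ ∃ i : Fin n, (i : ℕ) + 1 = k ∧ P.mark i = (d.2, d.1)))
  else none

/-- `(r, c)` is the cell of row `r` that the letter `x` enters in row insertion: the leftmost one
that is empty or has an entry greater than `x`. -/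
def RowCell (T : Filling ℕ) (r x c : ℕ) : Prop :=
  r ≤ c ∧ (∀ y, T (r, c) = some y → x < y) ∧
    ∀ e, r ≤ e → e < c → ∃ y, T (r, e) = some y ∧ y ≤ x

/-- `(r, c)` is the cell of column `c` that the letter `x` enters in column insertion: the first one
that is empty or has an entry greater than `x`. -/
def ColCell (T : Filling ℕ) (c x r : ℕ) : Prop :=
  r ≤ c ∧ (∀ y, T (r, c) = some y → x < y) ∧
    ∀ e, e < r → ∃ y, T (e, c) = some y ∧ y ≤ x

/-- The column phase: `ColInsert c T x U d` says that inserting `x` into column `c` of `T`, each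
bumped entry being inserted into the next column, leads to `U` with the new cell `d`. -/
inductive ColInsert : ℕ → Filling ℕ → ℕ → Filling ℕ → ℕ × ℕ → Prop
  | place (c x r : ℕ) (T : Filling ℕ) : ColCell T c x r → T (r, c) = none →
      ColInsert c T x (Function.update T (r, c) (some x)) (r, c)
  | bump (c x r y : ℕ) (T U : Filling ℕ) (d : ℕ × ℕ) : ColCell T c x r → T (r, c) = some y →
      ColInsert (c + 1) (Function.update T (r, c) (some x)) y U d → ColInsert c T x U d

/-- `RowInsert r T x U d b` says that inserting `x` into row `r` of `T` leads to `U` with the new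
cell `d`. An entry bumped off the main diagonal is inserted into the next row; when an entry on the
main diagonal, in column `r`, is bumped, the column phase starts with this entry and the next
column. The flag `b` says whether the process ends in the column phase. -/
inductive RowInsert : ℕ → Filling ℕ → ℕ → Filling ℕ → ℕ × ℕ → Bool → Prop
  | place (r x c : ℕ) (T : Filling ℕ) : RowCell T r x c → T (r, c) = none →
      RowInsert r T x (Function.update T (r, c) (some x)) (r, c) false
  | bump (r x c y : ℕ) (T U : Filling ℕ) (d : ℕ × ℕ) (b : Bool) :
      RowCell T r x c → T (r, c) = some y → r < c →
      RowInsert (r + 1) (Function.update T (r, c) (some x)) y U d b → RowInsert r T x U d b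
  | diag (r x y : ℕ) (T U : Filling ℕ) (d : ℕ × ℕ) :
      RowCell T r x r → T (r, r) = some y →
      ColInsert (r + 1) (Function.update T (r, r) (some x)) y U d → RowInsert r T x U d true

/-- `τ` maps to `(T, R)` under Sagan-Worley insertion: the letters `τ(1), …, τ(n)` are inserted one
after the other into the first row of the insertion tableau, and in the recording tableau the cell
created in step `k` gets the entry `k`, marked if step `k` ends in the column phase. -/
def SaganWorley {n : ℕ} (τ : Equiv.Perm (Fin n)) (T : Filling ℕ) (R : Filling (ℕ × Bool)) : Prop :=
  ∃ (Ts : Fin (n + 1) → Filling ℕ) (Rs : Fin (n + 1) → Filling (ℕ × Bool)),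
    (Ts 0 = fun _ => none) ∧ (Rs 0 = fun _ => none) ∧
    (∀ k : Fin n, ∃ (d : ℕ × ℕ) (b : Bool),
      RowInsert 0 (Ts k.castSucc) ((τ k : ℕ) + 1) (Ts k.succ) d b ∧
      Rs k.succ = Function.update (Rs k.castSucc) d (some ((k : ℕ) + 1, b))) ∧
    Ts (Fin.last n) = T ∧ Rs (Fin.last n) = R

end FoldedInsertion

namespace FoldedInsertion

/-! ### The group `W_∞` acting on symmetric subsets of `ℤ` -/

/-! The border word of a transpose-symmetric partition is determined by the finite set `A` of
nonnegative indices of its south steps. On such sets `s_0` toggles `0` and `s_{j+1}` exchanges `j`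
and `j + 1`, so a simple reflection raises `weight` by at most one. This bounds length below by
`weight`, and greedy words attain the bound. Minimal coset representatives are therefore exactly the
elements whose length is the weight of their image (`mem_minRepsC_iff`). A weak cover then adds an
addable cell together with its transpose (`SymCover`), and every such step is also a strong cover.
General strong covers need no classification: rules 2 and 3 ask for covers that are both strong and
weak, the other rules propagate them, and so only symmetric covers occur in a growth diagram.

For such edges the local rules become explicit (`localRule_iff`). In rule 3 the next addable cell is
always the end of the very next row. In rule 5 the reflections concerned commute, so the square is
completed by adding both pairs of cells and the marking is kept. Each square thus has a solution,
unique up to markings of degenerate edges. A horizontal edge is a cover exactly when a permutation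
entry lies above it, a vertical one when an entry lies to its left. Hence the bottom row and the
last column consist of covers only, and `(P, Q)` is well defined.

For the comparison, read each column of the growth diagram as a shifted tableau recording the rows
at which cells appear. Passing from column `j` to column `j + 1` is the insertion of the row number
of the entry in column `j`. This is proved in `rowInsert_growth` by restricting to letters at most
`i` and letting `i` grow, so that one new greatest letter is added at a time. That letter is either
untouched, or sits exactly where the insertion used to end. In the latter case it is bumped to the
end of the next row or of the next column, as rule 3 prescribes. A marking below the main diagonal
corresponds to the column phase. The bottom row records the new cells, and insertion is
deterministic, which gives the equivalence. -/

/-- The subset of `ℤ` that contains exactly one of `d` and `-1 - d` for all `d`, and whose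
nonnegative part is `A`. -/
def halfSet (A : Finset ℕ) : Set ℤ :=
  {d | (0 ≤ d ∧ d.toNat ∈ A) ∨ (d < 0 ∧ (-1 - d).toNat ∉ A)}

theorem natCast_mem_halfSet {A : Finset ℕ} (k : ℕ) : (k : ℤ) ∈ halfSet A ↔ k ∈ A := by
  simp [halfSet]

theorem neg_mem_halfSet {A : Finset ℕ} (k : ℕ) : (-1 - k : ℤ) ∈ halfSet A ↔ k ∉ A := by
  have h1 : ¬ (0 ≤ (-1 - k : ℤ)) := by omega
  have h2 : (-1 - k : ℤ) < 0 := by omega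
  rw [halfSet, Set.mem_ofPred_eq, sub_sub_cancel, Int.toNat_natCast]
  tauto

theorem int_eq_cast_or_neg (d : ℤ) : ∃ k : ℕ, d = k ∨ d = -1 - k := by
  rcases le_or_gt 0 d with h | h
  · exact ⟨d.toNat, Or.inl (by omega)⟩
  · exact ⟨(-1 - d).toNat, Or.inr (by omega)⟩

theorem halfSet_injective : Function.Injective halfSet := by
  intro A B h
  ext k
  rw [← natCast_mem_halfSet, h, natCast_mem_halfSet]

theorem mem_halfSet_empty (d : ℤ) : d ∈ halfSet ∅ ↔ d < 0 := by
  simp [halfSet]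

/-- The action of `simpleC i` on the nonnegative part of a symmetric set. -/
def act : ℕ → Finset ℕ → Finset ℕ
  | 0, A => symmDiff A {0}
  | j + 1, A => A.map (Equiv.swap j (j + 1)).toEmbedding

/-- The number of cells of the shifted diagram with row lengths `k + 1`, `k ∈ A`. -/
def weight (A : Finset ℕ) : ℕ := ∑ k ∈ A, (k + 1)

theorem mem_act_succ {j k : ℕ} {A : Finset ℕ} :
    k ∈ act (j + 1) A ↔ Equiv.swap j (j + 1) k ∈ A := by
  rw [act, Finset.mem_map_equiv, Equiv.symm_swap]

theorem simpleC_zero : simpleC 0 = Equiv.swap (-1) 0 := by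
  simp [simpleC, simpleA]

theorem simpleC_natCast (j k : ℕ) :
    simpleC (j + 1) (k : ℤ) = (Equiv.swap j (j + 1) k : ℕ) := by
  simp only [simpleC, simpleA, Equiv.swap_apply_def, Equiv.Perm.mul_apply, Nat.succ_ne_zero,
    if_false]
  push_cast
  split_ifs <;> omega

theorem simpleC_neg (i : ℕ) (d : ℤ) : simpleC i (-1 - d) = -1 - simpleC i d := by
  rcases i with _ | j
  · rw [simpleC_zero]
    simp only [Equiv.swap_apply_def]
    split_ifs <;> omega
  · simp only [simpleC, simpleA, Equiv.swap_apply_def, Equiv.Perm.mul_apply, Nat.succ_ne_zero,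
      if_false]
    push_cast
    split_ifs <;> omega

theorem simpleC_simpleC (i : ℕ) (d : ℤ) : simpleC i (simpleC i d) = d := by
  rcases i with _ | j
  · simp [simpleC_zero]
  · obtain ⟨k, rfl | rfl⟩ := int_eq_cast_or_neg d
    · simp [simpleC_natCast]
    · simp [simpleC_neg, simpleC_natCast]

theorem simpleC_mul_self (i : ℕ) : simpleC i * simpleC i = 1 :=
  Equiv.ext (simpleC_simpleC i)

theorem simpleC_inv (i : ℕ) : (simpleC i)⁻¹ = simpleC i :=
  inv_eq_of_mul_eq_one_left (simpleC_mul_self i)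

theorem mem_simpleC_image {i : ℕ} {S : Set ℤ} {d : ℤ} :
    d ∈ simpleC i '' S ↔ simpleC i d ∈ S := by
  constructor
  · rintro ⟨e, he, rfl⟩
    rwa [simpleC_simpleC]
  · intro h
    exact ⟨_, h, simpleC_simpleC i d⟩

theorem simpleC_image_halfSet (i : ℕ) (A : Finset ℕ) :
    simpleC i '' halfSet A = halfSet (act i A) := by
  ext d
  rw [mem_simpleC_image]
  obtain ⟨k, rfl | rfl⟩ := int_eq_cast_or_neg d
  · rcases i with _ | j
    · rw [simpleC_zero, natCast_mem_halfSet, act]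
      rcases k with _ | k
      · have := neg_mem_halfSet (A := A) 0
        simp only [Nat.cast_zero, sub_zero] at this
        simp [this, Finset.mem_symmDiff]
      · rw [Equiv.swap_apply_of_ne_of_ne (by omega) (by omega), natCast_mem_halfSet]
        simp [Finset.mem_symmDiff]
    · rw [simpleC_natCast, natCast_mem_halfSet, natCast_mem_halfSet, mem_act_succ]
  · rw [simpleC_neg]
    rcases i with _ | j
    · rw [simpleC_zero, neg_mem_halfSet, act]
      rcases k with _ | k
      · have := natCast_mem_halfSet (A := A) 0
        simp only [Nat.cast_zero] at this
        simp [this, Finset.mem_symmDiff]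
      · rw [Equiv.swap_apply_of_ne_of_ne (by omega) (by omega), neg_mem_halfSet]
        simp [Finset.mem_symmDiff]
    · rw [simpleC_natCast, neg_mem_halfSet, neg_mem_halfSet, mem_act_succ]

theorem act_act (i : ℕ) (A : Finset ℕ) : act i (act i A) = A := by
  apply halfSet_injective
  rw [← simpleC_image_halfSet, ← simpleC_image_halfSet, ← Set.image_comp]
  convert Set.image_id _
  exact funext (simpleC_simpleC i)

theorem weight_act_succ (j : ℕ) (A : Finset ℕ) :
    weight (act (j + 1) A) = ∑ k ∈ A, (Equiv.swap j (j + 1) k + 1) := by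
  simp [weight, act]

theorem weight_act_zero_of_notMem {A : Finset ℕ} (h : 0 ∉ A) :
    weight (act 0 A) = weight A + 1 := by
  have : act 0 A = insert 0 A := by
    ext k
    by_cases hk : k = 0 <;> simp [act, Finset.mem_symmDiff, hk, h]
  rw [this, weight, Finset.sum_insert h, weight]
  omega

theorem weight_act_zero_of_mem {A : Finset ℕ} (h : 0 ∈ A) :
    weight (act 0 A) + 1 = weight A := by
  have := weight_act_zero_of_notMem (A := act 0 A) (by simp [act, Finset.mem_symmDiff, h])
  rw [← this, act_act]

theorem weight_act_succ_le {j : ℕ} {A : Finset ℕ} (h : j ∉ A) :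
    weight (act (j + 1) A) ≤ weight A := by
  rw [weight_act_succ]
  refine Finset.sum_le_sum fun k hk => ?_
  have : k ≠ j := fun e => h (e ▸ hk)
  rw [Equiv.swap_apply_def]
  split_ifs <;> omega

theorem act_succ_of_mem {j : ℕ} {A : Finset ℕ} (h : j ∈ A) (h' : j + 1 ∈ A) :
    act (j + 1) A = A := by
  ext k
  rw [mem_act_succ, Equiv.swap_apply_def]
  split_ifs with h1 h2
  · simp [h1, h, h']
  · simp [h2, h, h']
  · rfl

theorem weight_act_succ_of_mem {j : ℕ} {A : Finset ℕ} (h : j ∈ A) (h' : j + 1 ∉ A) :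
    weight (act (j + 1) A) = weight A + 1 := by
  have e : ∀ k ∈ A, Equiv.swap j (j + 1) k + 1 = (k + 1) + if k = j then 1 else 0 := by
    intro k hk
    have : k ≠ j + 1 := fun e => h' (e ▸ hk)
    rw [Equiv.swap_apply_def]
    split_ifs <;> omega
  rw [weight_act_succ, Finset.sum_congr rfl e, Finset.sum_add_distrib]
  simp [h, weight]

/-- The condition that `simpleC i` raises the weight. -/
def Raises (i : ℕ) (A : Finset ℕ) : Prop := i ∉ A ∧ ∀ j, i = j + 1 → j ∈ A

theorem weight_act_of_raises {i : ℕ} {A : Finset ℕ} (h : Raises i A) :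
    weight (act i A) = weight A + 1 := by
  rcases i with _ | j
  · exact weight_act_zero_of_notMem h.1
  · exact weight_act_succ_of_mem (h.2 j rfl) h.1

theorem weight_act_of_not_raises {i : ℕ} {A : Finset ℕ} (h : ¬ Raises i A) :
    weight (act i A) ≤ weight A := by
  rcases i with _ | j
  · have : 0 ∈ A := by
      by_contra h'
      exact h ⟨h', by simp⟩
    have := weight_act_zero_of_mem this
    omega
  · by_cases hj : j ∈ A
    · have : j + 1 ∈ A := by
        by_contra h'
        exact h ⟨h', by rintro _ ⟨⟩; exact hj⟩
      rw [act_succ_of_mem hj this]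
    · exact weight_act_succ_le hj

/-! ### Words, lengths and minimal coset representatives. -/

theorem prod_mem_weylC (l : List ℕ) : (l.map simpleC).prod ∈ weylC := by
  refine Subgroup.list_prod_mem _ fun x hx => ?_
  obtain ⟨i, _, rfl⟩ := List.mem_map.1 hx
  exact Subgroup.subset_closure ⟨i, rfl⟩

theorem simpleC_mem_weylC (i : ℕ) : simpleC i ∈ weylC := Subgroup.subset_closure ⟨i, rfl⟩

theorem exists_word {w : Equiv.Perm ℤ} (hw : w ∈ weylC) :
    ∃ l : List ℕ, (l.map simpleC).prod = w := by
  refine Subgroup.closure_induction_left (p := fun w _ => ∃ l : List ℕ, (l.map simpleC).prod = w)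
    ⟨[], rfl⟩ ?_ ?_ hw
  · rintro _ ⟨i, rfl⟩ y _ ⟨l, rfl⟩
    exact ⟨i :: l, by simp⟩
  · rintro _ ⟨i, rfl⟩ y _ ⟨l, rfl⟩
    exact ⟨i :: l, by simp [simpleC_inv]⟩

/-- Each letter of a word raises the weight by at most one, which is the source of the lower bound
for lengths. -/
theorem exists_image_prod (l : List ℕ) :
    ∃ A, (l.map simpleC).prod '' halfSet ∅ = halfSet A ∧ weight A ≤ l.length := by
  induction l with
  | nil => exact ⟨∅, by simp, by simp [weight]⟩
  | cons i l ih =>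
    obtain ⟨A, hA, hl⟩ := ih
    refine ⟨act i A, ?_, ?_⟩
    · rw [List.map_cons, List.prod_cons, Equiv.Perm.coe_mul, Set.image_comp, hA,
        simpleC_image_halfSet]
    · by_cases h : Raises i A
      · simp [weight_act_of_raises h, hl]
      · exact (weight_act_of_not_raises h).trans (hl.trans (by simp))

theorem exists_word_of_finset (A : Finset ℕ) :
    ∃ l : List ℕ, l.length = weight A ∧ (l.map simpleC).prod '' halfSet ∅ = halfSet A := by
  induction hN : weight A using Nat.strong_induction_on generalizing A with
  | _ N ih =>
    rcases A.eq_empty_or_nonempty with rfl | hne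
    · exact ⟨[], by simpa [weight] using hN, by simp⟩
    · have hmin := Finset.min'_mem A hne
      have hlt : ∀ k ∈ A, A.min' hne ≤ k := fun k hk => Finset.min'_le A k hk
      generalize A.min' hne = i at hmin hlt
      -- With `i` the least element of `A`, `s_i` deletes it if `i = 0` and otherwise replaces it by
      -- the absent `i - 1`; either way the weight drops by one.
      have hr : Raises i (act i A) := by
        rcases i with _ | j
        · exact ⟨by simp [act, Finset.mem_symmDiff, hmin], by simp⟩
        · refine ⟨?_, ?_⟩
          · rw [mem_act_succ, Equiv.swap_apply_right]
            intro h
            have := hlt j h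
            omega
          · rintro _ ⟨⟩
            rwa [mem_act_succ, Equiv.swap_apply_left]
      have hw := weight_act_of_raises hr
      rw [act_act] at hw
      obtain ⟨l, hl, hl'⟩ := ih (weight (act i A)) (by omega) _ rfl
      refine ⟨i :: l, by simp [hl]; omega, ?_⟩
      rw [List.map_cons, List.prod_cons, Equiv.Perm.coe_mul, Set.image_comp, hl',
        simpleC_image_halfSet, act_act]

theorem weylC_neg {w : Equiv.Perm ℤ} (hw : w ∈ weylC) (d : ℤ) : w (-1 - d) = -1 - w d := by
  obtain ⟨l, rfl⟩ := exists_word hw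
  induction l with
  | nil => simp
  | cons i l ih => simp [ih (prod_mem_weylC l), simpleC_neg]

theorem weylC_finitary {w : Equiv.Perm ℤ} (hw : w ∈ weylC) :
    ∃ N : ℕ, ∀ k : ℕ, N ≤ k → w k = k := by
  obtain ⟨l, rfl⟩ := exists_word hw
  induction l with
  | nil => exact ⟨0, by simp⟩
  | cons i l ih =>
    obtain ⟨N, hN⟩ := ih (prod_mem_weylC l)
    refine ⟨max N (i + 1), fun k hk => ?_⟩
    rw [List.map_cons, List.prod_cons, Equiv.Perm.mul_apply, hN k (by omega)]
    rcases i with _ | j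
    · rw [simpleC_zero, Equiv.swap_apply_of_ne_of_ne] <;> omega
    · rw [simpleC_natCast, Equiv.swap_apply_of_ne_of_ne] <;> omega

theorem simpleC_nonneg (j : ℕ) (d : ℤ) : 0 ≤ simpleC (j + 1) d ↔ 0 ≤ d := by
  obtain ⟨k, rfl | rfl⟩ := int_eq_cast_or_neg d
  · simp [simpleC_natCast]
  · rw [simpleC_neg, simpleC_natCast]
    omega

/-- Such a `g` amounts to a permutation of `{0, …, N - 1}`, and the reflections `s_{j+1}` act there
as adjacent transpositions. -/
theorem mem_parabolicC_of_fixes (N : ℕ) (g : Equiv.Perm ℤ) (hneg : ∀ d, g (-1 - d) = -1 - g d)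
    (hpos : ∀ d, 0 ≤ g d ↔ 0 ≤ d) (hfix : ∀ k : ℕ, N ≤ k → g k = k) : g ∈ parabolicC := by
  induction N generalizing g with
  | zero =>
    have : g = 1 := by
      ext d
      obtain ⟨k, rfl | rfl⟩ := int_eq_cast_or_neg d
      · simp [hfix k]
      · simp [hneg, hfix k]
    rw [this]
    exact one_mem _
  | succ N ih =>
    obtain ⟨m, hm⟩ := Int.eq_ofNat_of_zero_le ((hpos N).2 (by omega))
    have hmN : m ≤ N := by
      by_contra h
      have h1 := hfix m (by omega)
      have h2 := g.injective (h1.trans hm.symm)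
      omega
    -- Inner induction on the distance of the value `m = g N` from `N`: composing with `s_{m+1}`
    -- moves this value up to `m + 1`.
    induction ht : N - m generalizing g m with
    | zero =>
      refine ih g hneg hpos fun k hk => ?_
      rcases hk.eq_or_lt with rfl | hk
      · rw [hm]; omega
      · exact hfix k hk
    | succ t iht =>
      have key := iht (simpleC (m + 1) * g) (by simp [hneg, simpleC_neg])
        (by simp [simpleC_nonneg, hpos]) (fun k hk => by
          rw [Equiv.Perm.mul_apply, hfix k hk, simpleC_natCast, Equiv.swap_apply_of_ne_of_ne] <;>
          omega) (m + 1) (by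
          rw [Equiv.Perm.mul_apply, hm, simpleC_natCast, Equiv.swap_apply_left]) (by omega)
          (by omega)
      have hs : simpleC (m + 1) ∈ parabolicC :=
        Subgroup.subset_closure ⟨m + 1, by simp, rfl⟩
      have := mul_mem hs key
      rwa [← mul_assoc, simpleC_mul_self, one_mul] at this

theorem mem_parabolicC_of_image {w : Equiv.Perm ℤ} (hw : w ∈ weylC)
    (h : w '' halfSet ∅ = halfSet ∅) : w ∈ parabolicC := by
  obtain ⟨N, hN⟩ := weylC_finitary hw
  refine mem_parabolicC_of_fixes N w (weylC_neg hw) (fun d => ?_) hN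
  have : w d ∈ w '' halfSet ∅ ↔ d ∈ halfSet ∅ := w.injective.mem_set_image
  rw [h, mem_halfSet_empty, mem_halfSet_empty] at this
  omega

theorem image_of_mem_parabolicC {y : Equiv.Perm ℤ} (hy : y ∈ parabolicC) :
    y ∈ weylC ∧ y '' halfSet ∅ = halfSet ∅ := by
  refine ⟨Subgroup.closure_mono (Set.image_subset_range _ _) hy, ?_⟩
  refine Subgroup.closure_induction (p := fun (y : Equiv.Perm ℤ) _ => y '' halfSet ∅ = halfSet ∅)
    ?_ ?_ ?_ ?_ hy
  · rintro _ ⟨i, hi, rfl⟩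
    rw [simpleC_image_halfSet]
    rcases i with _ | j
    · exact absurd rfl hi
    · simp [act]
  · simp
  · intro x y _ _ hx hy
    rw [Equiv.Perm.coe_mul, Set.image_comp, hy, hx]
  · intro x _ hx
    conv_lhs => rw [← hx]
    rw [← Set.image_comp, ← Equiv.Perm.coe_mul]
    simp

theorem weight_le_lengthC {w : Equiv.Perm ℤ} (hw : w ∈ weylC) {A : Finset ℕ}
    (hA : w '' halfSet ∅ = halfSet A) : weight A ≤ lengthC w := by
  obtain ⟨l, hl⟩ := exists_word hw
  obtain ⟨l, hl, hl'⟩ : lengthC w ∈ {k | ∃ l : List ℕ, l.length = k ∧ (l.map simpleC).prod = w} :=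
    Nat.sInf_mem ⟨_, l, rfl, hl⟩
  obtain ⟨B, hB, hle⟩ := exists_image_prod l
  rw [hl', hA] at hB
  rw [halfSet_injective hB]
  omega

theorem lengthC_prod_le (l : List ℕ) : lengthC (l.map simpleC).prod ≤ l.length :=
  Nat.sInf_le ⟨l, rfl, rfl⟩

theorem lengthC_simpleC_mul_le {w : Equiv.Perm ℤ} (hw : w ∈ weylC) (i : ℕ) :
    lengthC (simpleC i * w) ≤ lengthC w + 1 := by
  obtain ⟨l, hl⟩ := exists_word hw
  obtain ⟨l, hl, hl'⟩ : lengthC w ∈ {k | ∃ l : List ℕ, l.length = k ∧ (l.map simpleC).prod = w} :=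
    Nat.sInf_mem ⟨_, l, rfl, hl⟩
  have := lengthC_prod_le (i :: l)
  rwa [List.map_cons, List.prod_cons, hl', List.length_cons, hl] at this

/-- The image of the negative half-line determines the coset, and every coset contains an element
given by a word whose length is the weight of that image. -/
theorem mem_minRepsC_iff {w : Equiv.Perm ℤ} (hw : w ∈ weylC) {A : Finset ℕ}
    (hA : w '' halfSet ∅ = halfSet A) : w ∈ minRepsC ↔ lengthC w = weight A := by
  constructor
  · rintro ⟨_, h⟩
    refine le_antisymm ?_ (weight_le_lengthC hw hA)
    obtain ⟨l, hl, hl'⟩ := exists_word_of_finset A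
    have hu := prod_mem_weylC l
    set u := (l.map simpleC).prod with hu'
    have hy : w⁻¹ * u ∈ parabolicC := by
      refine mem_parabolicC_of_image (mul_mem (inv_mem hw) hu) ?_
      rw [Equiv.Perm.coe_mul, Set.image_comp, hl', ← hA, ← Set.image_comp, ← Equiv.Perm.coe_mul]
      simp
    have := h _ hy
    rw [mul_inv_cancel_left] at this
    exact this.trans (hl ▸ lengthC_prod_le l)
  · intro h
    refine ⟨hw, fun y hy => ?_⟩
    rw [h]
    obtain ⟨hy1, hy2⟩ := image_of_mem_parabolicC hy
    refine weight_le_lengthC (mul_mem hw hy1) ?_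
    rw [Equiv.Perm.coe_mul, Set.image_comp, hy2, hA]

theorem exists_image_of_mem_weylC {w : Equiv.Perm ℤ} (hw : w ∈ weylC) :
    ∃ A, w '' halfSet ∅ = halfSet A := by
  obtain ⟨l, rfl⟩ := exists_word hw
  obtain ⟨A, hA, _⟩ := exists_image_prod l
  exact ⟨A, hA⟩

theorem southSteps_bot : southSteps ⊥ = halfSet ∅ := by
  have h0 : ∀ r, (⊥ : YoungDiagram).rowLen r = 0 := by
    intro r
    by_contra h
    exact YoungDiagram.notMem_bot _ (YoungDiagram.mem_iff_lt_rowLen.2 (Nat.pos_of_ne_zero h))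
  ext d
  rw [mem_halfSet_empty]
  simp only [southSteps, h0, Set.mem_range]
  constructor
  · rintro ⟨r, rfl⟩
    push_cast
    omega
  · intro h
    exact ⟨(-1 - d).toNat, by push_cast; omega⟩

theorem exists_raises_of_weakCover {lam mu : YoungDiagram} (h : WeakCover lam mu) :
    ∃ A i, Raises i A ∧ southSteps lam = halfSet A ∧ southSteps mu = halfSet (act i A) := by
  obtain ⟨w, i, hw, hsw, hl, hlam, hmu⟩ := h
  obtain ⟨A, hA⟩ := exists_image_of_mem_weylC hw.1
  have hA' : (simpleC i * w) '' halfSet ∅ = halfSet (act i A) := by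
    rw [Equiv.Perm.coe_mul, Set.image_comp, hA, simpleC_image_halfSet]
  rw [Acts, southSteps_bot] at hlam hmu
  refine ⟨A, i, ?_, hlam.trans hA, hmu.trans hA'⟩
  rw [(mem_minRepsC_iff hw.1 hA).1 hw, (mem_minRepsC_iff hsw.1 hA').1 hsw] at hl
  by_contra h
  have := weight_act_of_not_raises h
  omega

theorem covers_of_raises {lam mu : YoungDiagram} {A : Finset ℕ} {i : ℕ} (hr : Raises i A)
    (hlam : southSteps lam = halfSet A) (hmu : southSteps mu = halfSet (act i A)) :
    WeakCover lam mu ∧ StrongCover lam mu := by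
  obtain ⟨l, hl, hA⟩ := exists_word_of_finset A
  have hw := prod_mem_weylC l
  have hle := lengthC_prod_le l
  set w := (l.map simpleC).prod
  have hA' : (simpleC i * w) '' halfSet ∅ = halfSet (act i A) := by
    rw [Equiv.Perm.coe_mul, Set.image_comp, hA, simpleC_image_halfSet]
  have hsw : simpleC i * w ∈ weylC := mul_mem (simpleC_mem_weylC i) hw
  have e1 : lengthC w = weight A := le_antisymm (by omega) (weight_le_lengthC hw hA)
  have e2 : lengthC (simpleC i * w) = weight (act i A) := by
    refine le_antisymm ?_ (weight_le_lengthC hsw hA')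
    rw [weight_act_of_raises hr, ← e1]
    exact lengthC_simpleC_mul_le hw i
  have m1 := (mem_minRepsC_iff hw hA).2 e1
  have m2 := (mem_minRepsC_iff hsw hA').2 e2
  have e3 : lengthC (simpleC i * w) = lengthC w + 1 := by
    rw [e1, e2, weight_act_of_raises hr]
  have a1 : Acts w ⊥ lam := by rw [Acts, southSteps_bot, hA, hlam]
  have a2 : Acts (simpleC i * w) ⊥ mu := by rw [Acts, southSteps_bot, hA', hmu]
  -- Left multiplication by `s_i` is right multiplication by the conjugate reflection `w⁻¹ s_i w`,
  -- so the weak cover is also a strong one.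
  have et : w * (w⁻¹ * simpleC i * w⁻¹⁻¹) = simpleC i * w := by group
  exact ⟨⟨w, i, m1, m2, e3, a1, a2⟩, w, w⁻¹ * simpleC i * w⁻¹⁻¹, ⟨w⁻¹, inv_mem hw, i, rfl⟩, m1,
    by rwa [et], by rwa [et], a1, by rwa [et]⟩

/-! ### Young diagrams and their border words -/

theorem southSteps_strictAnti (lam : YoungDiagram) :
    StrictAnti fun r : ℕ => (lam.rowLen r : ℤ) - r - 1 := by
  intro a b h
  have := lam.rowLen_anti a b h.le
  simp only
  omega

theorem eq_of_rowLen_eq {lam mu : YoungDiagram} (h : ∀ r, lam.rowLen r = mu.rowLen r) :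
    lam = mu := by
  ext ⟨r, c⟩
  rw [YoungDiagram.mem_cells, YoungDiagram.mem_cells, YoungDiagram.mem_iff_lt_rowLen,
    YoungDiagram.mem_iff_lt_rowLen, h]

theorem southSteps_injective : Function.Injective southSteps := by
  intro lam mu h
  have h1 : StrictMono fun r : ℕ => OrderDual.toDual ((lam.rowLen r : ℤ) - r - 1) :=
    fun a b hab => southSteps_strictAnti lam hab
  have h2 : StrictMono fun r : ℕ => OrderDual.toDual ((mu.rowLen r : ℤ) - r - 1) :=
    fun a b hab => southSteps_strictAnti mu hab
  have h3 := (StrictMono.range_inj h1 h2).1 h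
  refine eq_of_rowLen_eq fun r => ?_
  have h4 : (lam.rowLen r : ℤ) - r - 1 = (mu.rowLen r : ℤ) - r - 1 := congrFun h3 r
  omega

/-- Transposition reverses the border word by `d ↦ -1 - d` and exchanges south steps and east steps.
-/
theorem mem_southSteps_transpose (lam : YoungDiagram) (d : ℤ) :
    d ∈ southSteps lam.transpose ↔ -1 - d ∉ southSteps lam := by
  constructor
  · rintro ⟨c, rfl⟩ ⟨r, hr⟩
    simp only [YoungDiagram.rowLen_transpose] at hr
    by_cases h : (r, c) ∈ lam
    · have h1 := YoungDiagram.mem_iff_lt_rowLen.1 h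
      have h2 := YoungDiagram.mem_iff_lt_colLen.1 h
      omega
    · have h1 := mt YoungDiagram.mem_iff_lt_rowLen.2 h
      have h2 := mt YoungDiagram.mem_iff_lt_colLen.2 h
      omega
  · intro h
    -- Let `r` be the first row whose south step has index at most `-1 - d`. As equality is
    -- excluded, the step `-1 - d` is an east step, and it closes the column `c = r - 1 - d`, of
    -- height `r`.
    have hex : ∃ r : ℕ, (lam.rowLen r : ℤ) - r - 1 ≤ -1 - d := by
      refine ⟨(lam.rowLen 0 + d).toNat, ?_⟩
      have := lam.rowLen_anti 0 (lam.rowLen 0 + d).toNat (Nat.zero_le _)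
      omega
    classical
    have h1 := Nat.find_spec hex
    have h2 : ∀ r < Nat.find hex, ¬ (lam.rowLen r : ℤ) - r - 1 ≤ -1 - d :=
      fun r hr => Nat.find_min hex hr
    generalize Nat.find hex = r at h1 h2
    have h3 : (lam.rowLen r : ℤ) - r - 1 ≠ -1 - d := fun e => h ⟨r, e⟩
    refine ⟨(r - 1 - d).toNat, ?_⟩
    have hc : ((r - 1 - d).toNat : ℤ) = r - 1 - d := by omega
    generalize (r - 1 - d).toNat = c at hc
    simp only [YoungDiagram.rowLen_transpose]
    have h5 : ¬ r < lam.colLen c := by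
      rw [← YoungDiagram.mem_iff_lt_colLen, YoungDiagram.mem_iff_lt_rowLen]
      omega
    have h6 : r ≤ lam.colLen c := by
      rcases r with _ | r
      · omega
      · have := h2 r (Nat.lt_succ_self r)
        rw [Nat.succ_le_iff, ← YoungDiagram.mem_iff_lt_colLen, YoungDiagram.mem_iff_lt_rowLen]
        omega
    omega

/-- Invariance under transposition. -/
def IsSymm (lam : YoungDiagram) : Prop := ∀ d, d ∈ lam ↔ d.swap ∈ lam

theorem isSymm_iff_transpose {lam : YoungDiagram} : IsSymm lam ↔ lam.transpose = lam := by
  constructor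
  · intro h
    ext d
    rw [YoungDiagram.mem_cells, YoungDiagram.mem_cells, YoungDiagram.mem_transpose, h d]
  · intro h d
    conv_lhs => rw [← h]
    exact YoungDiagram.mem_transpose

theorem isSymm_of_southSteps {lam : YoungDiagram} {A : Finset ℕ}
    (h : southSteps lam = halfSet A) : IsSymm lam := by
  rw [isSymm_iff_transpose]
  apply southSteps_injective
  ext d
  rw [mem_southSteps_transpose, h]
  obtain ⟨k, rfl | rfl⟩ := int_eq_cast_or_neg d
  · rw [neg_mem_halfSet, natCast_mem_halfSet, not_not]
  · rw [sub_sub_cancel, neg_mem_halfSet, natCast_mem_halfSet]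

theorem exists_southSteps_eq {lam : YoungDiagram} (h : IsSymm lam) :
    ∃ A, southSteps lam = halfSet A := by
  classical
  refine ⟨(Finset.range (lam.rowLen 0)).filter fun k : ℕ => (k : ℤ) ∈ southSteps lam, ?_⟩
  have key : ∀ k : ℕ, (k : ℤ) ∈ southSteps lam ↔
      k ∈ (Finset.range (lam.rowLen 0)).filter fun k : ℕ => (k : ℤ) ∈ southSteps lam := by
    intro k
    rw [Finset.mem_filter, Finset.mem_range, iff_and_self]
    rintro ⟨r, hr⟩
    have := lam.rowLen_anti 0 r (Nat.zero_le _)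
    simp only at hr
    omega
  ext d
  obtain ⟨k, rfl | rfl⟩ := int_eq_cast_or_neg d
  · rw [natCast_mem_halfSet, key]
  · rw [neg_mem_halfSet, ← key]
    conv_lhs => rw [← isSymm_iff_transpose.1 h]
    rw [mem_southSteps_transpose, sub_sub_cancel]

/-! ### Addable cells and their diagonals. -/

theorem isAddable_iff {lam : YoungDiagram} {m : ℕ × ℕ} :
    IsAddable lam m ↔ m ∉ lam ∧ ∀ d ≤ m, d ≠ m → d ∈ lam := by
  constructor
  · rintro ⟨nu, h1, h2⟩
    refine ⟨h1, fun d hd hne => ?_⟩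
    have hm : m ∈ nu.cells := by rw [h2]; exact Finset.mem_insert_self _ _
    have := nu.isLowerSet hd hm
    rw [Finset.mem_coe, h2, Finset.mem_insert] at this
    exact this.resolve_left hne
  · rintro ⟨h1, h2⟩
    refine ⟨⟨insert m lam.cells, ?_⟩, h1, rfl⟩
    intro a b hba ha
    rw [Finset.mem_coe, Finset.mem_insert] at ha ⊢
    by_cases hb : b = m
    · exact Or.inl hb
    · rcases ha with rfl | ha
      · exact Or.inr (h2 b hba hb)
      · exact Or.inr (lam.isLowerSet hba ha)

theorem IsAddable.snd_eq {lam : YoungDiagram} {m : ℕ × ℕ} (h : IsAddable lam m) :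
    m.2 = lam.rowLen m.1 := by
  obtain ⟨h1, h2⟩ := isAddable_iff.1 h
  have h3 : ¬ m.2 < lam.rowLen m.1 := fun hlt => h1 (YoungDiagram.mem_iff_lt_rowLen.2 hlt)
  by_contra hne
  have h4 := h2 (m.1, lam.rowLen m.1) ⟨le_rfl, by simp only; omega⟩
    (fun e => hne (by rw [← e]))
  exact lt_irrefl _ (YoungDiagram.mem_iff_lt_rowLen.1 h4)

theorem isAddable_rowLen_iff {lam : YoungDiagram} {r : ℕ} :
    IsAddable lam (r, lam.rowLen r) ↔ ∀ r' < r, lam.rowLen r < lam.rowLen r' := by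
  rw [isAddable_iff]
  constructor
  · rintro ⟨_, h⟩ r' hr
    rw [← YoungDiagram.mem_iff_lt_rowLen]
    exact h _ ⟨hr.le, le_rfl⟩ (fun e => hr.ne (congrArg Prod.fst e))
  · intro h
    refine ⟨fun h' => lt_irrefl _ (YoungDiagram.mem_iff_lt_rowLen.1 h'), ?_⟩
    rintro ⟨a, b⟩ ⟨h1, h2⟩ hne
    simp only at h1 h2
    rw [YoungDiagram.mem_iff_lt_rowLen]
    rcases h1.eq_or_lt with rfl | h1
    · refine lt_of_le_of_ne h2 fun e => hne (by rw [e])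
    · exact h2.trans_lt (h a h1)

theorem IsAddable.swap {lam : YoungDiagram} (hs : IsSymm lam) {m : ℕ × ℕ} (h : IsAddable lam m) :
    IsAddable lam m.swap := by
  rw [isAddable_iff] at h ⊢
  refine ⟨fun h' => h.1 ((hs m).2 h'), fun d hd hne => ?_⟩
  rw [hs d]
  exact h.2 _ ⟨hd.2, hd.1⟩ fun e => hne (by rw [← e, Prod.swap_swap])

theorem IsAddable.mem_southSteps {lam : YoungDiagram} {m : ℕ × ℕ} (h : IsAddable lam m) :
    ((m.2 : ℤ) - m.1 - 1) ∈ southSteps lam ∧ ((m.2 : ℤ) - m.1) ∉ southSteps lam := by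
  obtain ⟨r, c⟩ := m
  obtain rfl : c = lam.rowLen r := h.snd_eq
  refine ⟨⟨r, rfl⟩, ?_⟩
  rintro ⟨r', hr'⟩
  simp only at hr'
  rcases lt_or_ge r' r with hlt | hge
  · have := isAddable_rowLen_iff.1 h r' hlt
    omega
  · have := lam.rowLen_anti r r' hge
    omega

/-- A south step followed by an east step is an inner corner of the border, where a cell fits. -/
theorem exists_isAddable {lam : YoungDiagram} {j : ℤ} (h : j - 1 ∈ southSteps lam)
    (h' : j ∉ southSteps lam) : ∃ m : ℕ × ℕ, IsAddable lam m ∧ (m.2 : ℤ) - m.1 = j := by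
  obtain ⟨r, hr⟩ := h
  simp only at hr
  refine ⟨(r, lam.rowLen r), isAddable_rowLen_iff.2 ?_, by simp only; omega⟩
  rcases r with _ | r
  · simp
  · intro r' hr'
    have h1 := lam.rowLen_anti r' r (by omega)
    have h2 := lam.rowLen_anti r (r + 1) (by omega)
    have h3 : lam.rowLen r ≠ lam.rowLen (r + 1) := by
      intro e
      refine h' ⟨r, ?_⟩
      simp only
      push_cast at hr
      omega
    omega

theorem mem_simpleA_image {j d : ℤ} {S : Set ℤ} :
    d ∈ simpleA j '' S ↔ simpleA j d ∈ S := by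
  rw [Equiv.image_eq_preimage_symm, simpleA, Equiv.symm_swap, Set.mem_preimage]

/-- Only the row of the new cell changes, and its south step moves from the index just below the
diagonal of the cell to that diagonal. -/
theorem AddCell.acts {lam nu : YoungDiagram} {m : ℕ × ℕ} (h : AddCell lam m nu) :
    Acts (simpleA ((m.2 : ℤ) - m.1)) lam nu := by
  have ha : IsAddable lam m := ⟨nu, h⟩
  obtain ⟨h1, h2⟩ := ha.mem_southSteps
  have hmem : ∀ r c, c < nu.rowLen r ↔ (r, c) = m ∨ c < lam.rowLen r := by
    intro r c
    rw [← YoungDiagram.mem_iff_lt_rowLen, ← YoungDiagram.mem_iff_lt_rowLen,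
      ← YoungDiagram.mem_cells, h.2, Finset.mem_insert, YoungDiagram.mem_cells]
  have hm := ha.snd_eq
  obtain ⟨r, c⟩ := m
  simp only at hm h1 h2 ⊢
  have hr : nu.rowLen r = c + 1 := by
    apply le_antisymm
    · by_contra hlt
      have := (hmem r (c + 1)).1 (by omega)
      simp at this
      omega
    · exact (hmem r c).2 (Or.inl rfl)
  have hr' : ∀ r' ≠ r, nu.rowLen r' = lam.rowLen r' := by
    intro r' hne
    refine eq_of_forall_lt_iff fun e => ?_
    rw [hmem]
    simp [hne]
  rw [Acts]
  ext d
  rw [mem_simpleA_image, simpleA, Equiv.swap_apply_def]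
  split_ifs with e1 e2
  · subst e1
    refine iff_of_false ?_ h2
    rintro ⟨r', hr2⟩
    simp only at hr2
    by_cases e : r' = r
    · subst e
      omega
    · rw [hr' r' e, hm] at hr2
      exact e ((southSteps_strictAnti lam).injective hr2)
  · subst e2
    refine iff_of_true ⟨r, ?_⟩ h1
    simp only [hr]
    push_cast
    ring
  · constructor
    · rintro ⟨r', rfl⟩
      by_cases e : r' = r
      · subst e
        exact absurd (by simp only [hr]; push_cast; ring) e2
      · simp only [hr' r' e]
        exact ⟨r', rfl⟩
    · rintro ⟨r', rfl⟩
      by_cases e : r' = r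
      · subst e
        exact absurd (by simp only [hm]) e1
      · exact ⟨r', by simp only [hr' r' e]⟩

/-! ### Adding a cell together with its transpose. -/

/-- `mu` is obtained from the symmetric diagram `lam` by adding the addable cell `m` and its
transpose. -/
structure SymCover (lam mu : YoungDiagram) (m : ℕ × ℕ) : Prop where
  symm : IsSymm lam
  addable : IsAddable lam m
  mem_iff : ∀ d, d ∈ mu ↔ d ∈ lam ∨ d = m ∨ d = m.swap

theorem SymCover.swap {lam mu : YoungDiagram} {m : ℕ × ℕ} (h : SymCover lam mu m) :
    SymCover lam mu m.swap :=
  ⟨h.symm, h.addable.swap h.symm, fun d => by rw [h.mem_iff, Prod.swap_swap, or_comm (a := d = m)]⟩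

theorem SymCover.notMem {lam mu : YoungDiagram} {m : ℕ × ℕ} (h : SymCover lam mu m) : m ∉ lam :=
  (isAddable_iff.1 h.addable).1

theorem SymCover.mem {lam mu : YoungDiagram} {m : ℕ × ℕ} (h : SymCover lam mu m) : m ∈ mu :=
  (h.mem_iff m).2 (Or.inr (Or.inl rfl))

theorem SymCover.ne {lam mu : YoungDiagram} {m : ℕ × ℕ} (h : SymCover lam mu m) : lam ≠ mu :=
  fun e => h.notMem (e ▸ h.mem)

theorem SymCover.isSymm_right {lam mu : YoungDiagram} {m : ℕ × ℕ} (h : SymCover lam mu m) :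
    IsSymm mu := by
  intro d
  rw [h.mem_iff, h.mem_iff, h.symm d, Prod.swap_inj]
  have : d.swap = m ↔ d = m.swap := by
    constructor <;> rintro rfl <;> simp
  rw [this, or_comm (a := d = m)]

theorem SymCover.unique {lam mu mu' : YoungDiagram} {m : ℕ × ℕ} (h : SymCover lam mu m)
    (h' : SymCover lam mu' m) : mu = mu' := by
  ext d
  rw [YoungDiagram.mem_cells, YoungDiagram.mem_cells, h.mem_iff, h'.mem_iff]

theorem SymCover.eq_or_eq {lam mu : YoungDiagram} {m e : ℕ × ℕ} (h : SymCover lam mu m)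
    (he : e ∉ lam) (he' : e ∈ mu) : e = m ∨ e = m.swap :=
  ((h.mem_iff e).1 he').resolve_left he

theorem SymCover.of_mem {lam mu : YoungDiagram} {m e : ℕ × ℕ} (h : SymCover lam mu m)
    (he : e ∉ lam) (he' : e ∈ mu) : SymCover lam mu e := by
  rcases h.eq_or_eq he he' with rfl | rfl
  · exact h
  · exact h.swap

theorem exists_symCover {lam : YoungDiagram} (hs : IsSymm lam) {m : ℕ × ℕ}
    (h : IsAddable lam m) : ∃ mu, SymCover lam mu m := by
  refine ⟨⟨insert m (insert m.swap lam.cells), ?_⟩, hs, h, fun d => ?_⟩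
  · have h1 := (isAddable_iff.1 h).2
    have h2 := (isAddable_iff.1 (h.swap hs)).2
    intro a b hba ha
    simp only [Finset.mem_coe, Finset.mem_insert] at ha ⊢
    by_cases hb : b = m
    · exact Or.inl hb
    by_cases hb' : b = m.swap
    · exact Or.inr (Or.inl hb')
    rcases ha with rfl | rfl | ha
    · exact Or.inr (Or.inr (h1 b hba hb))
    · exact Or.inr (Or.inr (h2 b hba hb'))
    · exact Or.inr (Or.inr (lam.isLowerSet hba ha))
  · rw [← YoungDiagram.mem_cells]
    simp only [Finset.mem_insert, YoungDiagram.mem_cells]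
    tauto

theorem SymCover.acts {lam mu : YoungDiagram} {m : ℕ × ℕ} (h : SymCover lam mu m) :
    Acts (simpleC ((m.2 : ℤ) - m.1).natAbs) lam mu := by
  wlog hm : m.1 ≤ m.2 generalizing m
  · have := this h.swap (by simp only [Prod.fst_swap, Prod.snd_swap]; omega)
    convert this using 2
    simp only [Prod.fst_swap, Prod.snd_swap]
    omega
  by_cases hd : m.1 = m.2
  · have hsw : m.swap = m := by
      ext <;> simp [hd]
    have : AddCell lam m mu := ⟨h.notMem, by
      ext d
      rw [Finset.mem_insert, YoungDiagram.mem_cells, YoungDiagram.mem_cells, h.mem_iff, hsw]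
      tauto⟩
    have := this.acts
    simpa [hd, simpleC] using this
  -- Off the main diagonal the two cells are added one at a time, which yields the two factors of
  -- `s_i s_{-i}`.
  · obtain ⟨nu, hnu⟩ := h.swap.addable
    have hmnu : AddCell nu m mu := by
      refine ⟨?_, ?_⟩
      · rw [← YoungDiagram.mem_cells, hnu.2, Finset.mem_insert, YoungDiagram.mem_cells]
        rintro (e | e)
        · exact hd (congrArg Prod.fst e)
        · exact h.notMem e
      · ext d
        rw [hnu.2, Finset.mem_insert, Finset.mem_insert, YoungDiagram.mem_cells,
          YoungDiagram.mem_cells, h.mem_iff]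
        tauto
    have h1 := hnu.acts
    have h2 := hmnu.acts
    rw [Acts] at h1 h2 ⊢
    rw [h2, h1, ← Set.image_comp, ← Equiv.Perm.coe_mul, simpleC, if_neg (by omega)]
    simp only [Prod.fst_swap, Prod.snd_swap]
    have e1 : (((m.2 : ℤ) - m.1).natAbs : ℤ) = (m.2 : ℤ) - m.1 := by omega
    have e2 : -((m.2 : ℤ) - m.1) = (m.1 : ℤ) - m.2 := by ring
    rw [e1, e2]

theorem SymCover.raises {lam mu : YoungDiagram} {m : ℕ × ℕ} (h : SymCover lam mu m)
    {A : Finset ℕ} (hA : southSteps lam = halfSet A) :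
    Raises ((m.2 : ℤ) - m.1).natAbs A := by
  wlog hm : m.1 ≤ m.2 generalizing m
  · have := this h.swap (by simp only [Prod.fst_swap, Prod.snd_swap]; omega)
    convert this using 1
    simp only [Prod.fst_swap, Prod.snd_swap]
    omega
  obtain ⟨h1, h2⟩ := h.addable.mem_southSteps
  have e : (m.2 : ℤ) - m.1 = (((m.2 : ℤ) - m.1).natAbs : ℕ) := by omega
  generalize ((m.2 : ℤ) - m.1).natAbs = i at e
  rw [e, hA] at h1 h2
  refine ⟨fun hi => h2 ((natCast_mem_halfSet i).2 hi), ?_⟩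
  rintro j rfl
  rw [← natCast_mem_halfSet]
  simpa using h1

theorem SymCover.covers {lam mu : YoungDiagram} {m : ℕ × ℕ} (h : SymCover lam mu m) :
    WeakCover lam mu ∧ StrongCover lam mu := by
  obtain ⟨A, hA⟩ := exists_southSteps_eq h.symm
  refine covers_of_raises (h.raises hA) hA ?_
  rw [← simpleC_image_halfSet, ← hA]
  exact h.acts

/-- If `s_i` raises the weight, the border word has a south step at `i - 1` and an east step at `i`.
Adding the cell of diagonal `i` and its transpose has the same effect as `s_i`. -/
theorem exists_symCover_of_weakCover {lam mu : YoungDiagram} (h : WeakCover lam mu) :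
    ∃ m, SymCover lam mu m := by
  obtain ⟨A, i, hr, hlam, hmu⟩ := exists_raises_of_weakCover h
  have h1 : (i : ℤ) - 1 ∈ southSteps lam := by
    rw [hlam]
    rcases i with _ | j
    · have := (neg_mem_halfSet (A := A) 0).2 hr.1
      simpa using this
    · have := (natCast_mem_halfSet (A := A) j).2 (hr.2 j rfl)
      simpa using this
  have h2 : (i : ℤ) ∉ southSteps lam := by
    rw [hlam, natCast_mem_halfSet]
    exact hr.1
  obtain ⟨m, hm, hi⟩ := exists_isAddable h1 h2
  obtain ⟨nu, hnu⟩ := exists_symCover (isSymm_of_southSteps hlam) hm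
  have := hnu.acts
  rw [hi, Int.natAbs_natCast, Acts, hlam, simpleC_image_halfSet, ← hmu] at this
  obtain rfl := southSteps_injective this
  exact ⟨m, hnu⟩

theorem SymCover.upDown {lam mu : YoungDiagram} {m : ℕ × ℕ} (h : SymCover lam mu m) :
    UpDown lam mu m :=
  ⟨⟨h.covers.2, h.addable, h.mem⟩, h.covers.1⟩

/-- The weak cover fixes the pair of added cells, and the marking has to be one of the two. This
removes the Coxeter group from the rest of the argument, apart from rule 5. -/
theorem upDown_iff {lam mu : YoungDiagram} {m : ℕ × ℕ} :
    UpDown lam mu m ↔ SymCover lam mu m := by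
  constructor
  · rintro ⟨⟨_, ha, hm⟩, hw⟩
    obtain ⟨e, he⟩ := exists_symCover_of_weakCover hw
    exact he.of_mem (isAddable_iff.1 ha).1 hm
  · exact SymCover.upDown

/-! ### Sagan-Worley insertion -/

theorem RowCell.unique {T : Filling ℕ} {r x c c' : ℕ} (h : RowCell T r x c)
    (h' : RowCell T r x c') : c = c' := by
  rcases lt_trichotomy c c' with hlt | heq | hlt
  · obtain ⟨y, hy, hyx⟩ := h'.2.2 c h.1 hlt
    have := h.2.1 y hy
    omega
  · exact heq
  · obtain ⟨y, hy, hyx⟩ := h.2.2 c' h'.1 hlt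
    have := h'.2.1 y hy
    omega

theorem ColCell.unique {T : Filling ℕ} {c x r r' : ℕ} (h : ColCell T c x r)
    (h' : ColCell T c x r') : r = r' := by
  rcases lt_trichotomy r r' with hlt | heq | hlt
  · obtain ⟨y, hy, hyx⟩ := h'.2.2 r hlt
    have := h.2.1 y hy
    omega
  · exact heq
  · obtain ⟨y, hy, hyx⟩ := h.2.2 r' hlt
    have := h'.2.1 y hy
    omega

theorem ColInsert.unique {c : ℕ} {T U U' : Filling ℕ} {x : ℕ} {d d' : ℕ × ℕ}
    (h : ColInsert c T x U d) (h' : ColInsert c T x U' d') : U = U' ∧ d = d' := by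
  induction h generalizing U' d' with
  | place c x r T hr hn =>
    cases h' with
    | place _ _ r' _ hr' hn' =>
      obtain rfl := hr.unique hr'
      exact ⟨rfl, rfl⟩
    | bump _ _ r' y' _ _ _ hr' hn' _ =>
      obtain rfl := hr.unique hr'
      rw [hn] at hn'
      cases hn'
  | bump c x r y T U d hr hn _ ih =>
    cases h' with
    | place _ _ r' _ hr' hn' =>
      obtain rfl := hr.unique hr'
      rw [hn] at hn'
      cases hn'
    | bump _ _ r' y' _ _ _ hr' hn' h2 =>
      obtain rfl := hr.unique hr'
      rw [hn] at hn'
      cases hn'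
      exact ih h2

theorem RowInsert.unique {r : ℕ} {T U U' : Filling ℕ} {x : ℕ} {d d' : ℕ × ℕ} {b b' : Bool}
    (h : RowInsert r T x U d b) (h' : RowInsert r T x U' d' b') : U = U' ∧ d = d' ∧ b = b' := by
  induction h generalizing U' d' b' with
  | place r x c T hc hn =>
    cases h' with
    | place _ _ c' _ hc' hn' =>
      obtain rfl := hc.unique hc'
      exact ⟨rfl, rfl, rfl⟩
    | bump _ _ c' y' _ _ _ _ hc' hn' _ _ =>
      obtain rfl := hc.unique hc'
      rw [hn] at hn'
      cases hn'
    | diag _ _ y' _ _ _ hc' hn' _ =>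
      obtain rfl := hc.unique hc'
      rw [hn] at hn'
      cases hn'
  | bump r x c y T U d b hc hn hlt _ ih =>
    cases h' with
    | place _ _ c' _ hc' hn' =>
      obtain rfl := hc.unique hc'
      rw [hn] at hn'
      cases hn'
    | bump _ _ c' y' _ _ _ _ hc' hn' _ h2 =>
      obtain rfl := hc.unique hc'
      rw [hn] at hn'
      cases hn'
      exact ih h2
    | diag _ _ y' _ _ _ hc' hn' _ =>
      obtain rfl := hc.unique hc'
      exact absurd hlt (lt_irrefl _)
  | diag r x y T U d hc hn h1 =>
    cases h' with
    | place _ _ c' _ hc' hn' =>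
      obtain rfl := hc.unique hc'
      rw [hn] at hn'
      cases hn'
    | bump _ _ c' y' _ _ _ _ hc' hn' hlt _ =>
      obtain rfl := hc.unique hc'
      exact absurd hlt (lt_irrefl _)
    | diag _ _ y' _ _ _ hc' hn' h2 =>
      rw [hn] at hn'
      cases hn'
      obtain ⟨e1, e2⟩ := h1.unique h2
      exact ⟨e1, e2, rfl⟩

theorem SaganWorley.unique {n : ℕ} {τ : Equiv.Perm (Fin n)} {T T' : Filling ℕ}
    {R R' : Filling (ℕ × Bool)} (h : SaganWorley τ T R) (h' : SaganWorley τ T' R') :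
    T = T' ∧ R = R' := by
  obtain ⟨Ts, Rs, hT0, hR0, hs, rfl, rfl⟩ := h
  obtain ⟨Ts', Rs', hT0', hR0', hs', rfl, rfl⟩ := h'
  have key : ∀ k : Fin (n + 1), Ts k = Ts' k ∧ Rs k = Rs' k := by
    intro k
    induction k using Fin.induction with
    | zero => exact ⟨hT0.trans hT0'.symm, hR0.trans hR0'.symm⟩
    | succ k ih =>
      obtain ⟨d, b, h1, h2⟩ := hs k
      obtain ⟨d', b', h1', h2'⟩ := hs' k
      rw [← ih.1] at h1'
      rw [← ih.2] at h2'
      obtain ⟨e1, rfl, rfl⟩ := h1.unique h1'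
      exact ⟨e1, h2.trans h2'.symm⟩
  exact key _

/-! ### The effect of an additional letter on an insertion. -/

theorem RowCell.update {T : Filling ℕ} {r x c : ℕ} (h : RowCell T r x c) {e : ℕ × ℕ}
    (he : T e = none) (hne : e ≠ (r, c)) (N : ℕ) :
    RowCell (Function.update T e (some N)) r x c := by
  refine ⟨h.1, fun y hy => ?_, fun a h1 h2 => ?_⟩
  · rw [Function.update_of_ne hne.symm] at hy
    exact h.2.1 y hy
  · obtain ⟨y, hy, hyx⟩ := h.2.2 a h1 h2
    refine ⟨y, ?_, hyx⟩
    rw [Function.update_of_ne, hy]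
    rintro rfl
    rw [he] at hy
    cases hy

theorem ColCell.update {T : Filling ℕ} {c x r : ℕ} (h : ColCell T c x r) {e : ℕ × ℕ}
    (he : T e = none) (hne : e ≠ (r, c)) (N : ℕ) :
    ColCell (Function.update T e (some N)) c x r := by
  refine ⟨h.1, fun y hy => ?_, fun a h1 => ?_⟩
  · rw [Function.update_of_ne hne.symm] at hy
    exact h.2.1 y hy
  · obtain ⟨y, hy, hyx⟩ := h.2.2 a h1
    refine ⟨y, ?_, hyx⟩
    rw [Function.update_of_ne, hy]
    rintro rfl
    rw [he] at hy
    cases hy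

theorem ne_of_eq_none {T : Filling ℕ} {e e' : ℕ × ℕ} {y : ℕ} (h : T e = none)
    (h' : T e' = some y) : e ≠ e' := by
  rintro rfl
  rw [h] at h'
  cases h'

theorem update_eq_none {T : Filling ℕ} {e e' : ℕ × ℕ} {y : ℕ} (h : T e = none) (hne : e ≠ e') :
    Function.update T e' (some y) e = none := by
  rw [Function.update_of_ne hne, h]

theorem eq_none_of_update {T : Filling ℕ} {e e' : ℕ × ℕ} {y : ℕ}
    (h : Function.update T e' (some y) e = none) : T e = none := by
  by_cases hne : e = e'
  · subst hne
    simp at h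
  · rwa [Function.update_of_ne hne] at h

theorem ColInsert.apply_eq_none {c : ℕ} {T U : Filling ℕ} {x : ℕ} {d : ℕ × ℕ}
    (h : ColInsert c T x U d) : T d = none := by
  induction h with
  | place c x r T hr hn => exact hn
  | bump c x r y T U d hr hn _ ih => exact eq_none_of_update ih

theorem RowInsert.apply_eq_none {r : ℕ} {T U : Filling ℕ} {x : ℕ} {d : ℕ × ℕ} {b : Bool}
    (h : RowInsert r T x U d b) : T d = none := by
  induction h with
  | place r x c T hc hn => exact hn
  | bump r x c y T U d b hc hn hlt _ ih => exact eq_none_of_update ih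
  | diag r x y T U d hc hn h1 => exact eq_none_of_update h1.apply_eq_none

/-- The cells that an insertion reads before its end are all occupied, so a letter put into an empty
cell other than the final one is never met. -/
theorem ColInsert.update {c : ℕ} {T U : Filling ℕ} {x : ℕ} {d : ℕ × ℕ}
    (h : ColInsert c T x U d) {e : ℕ × ℕ} (he : T e = none) (hne : e ≠ d) (N : ℕ) :
    ColInsert c (Function.update T e (some N)) x (Function.update U e (some N)) d := by
  induction h with
  | place c x r T hr hn =>
    rw [Function.update_comm hne.symm]
    exact .place _ _ _ _ (hr.update he hne N) (update_eq_none hn hne.symm)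
  | bump c x r y T U d hr hn _ ih =>
    have h1 := ne_of_eq_none he hn
    refine .bump _ _ _ y _ _ _ (hr.update he h1 N) (by rwa [Function.update_of_ne h1.symm]) ?_
    rw [Function.update_comm h1]
    exact ih (update_eq_none he h1) hne

theorem RowInsert.update {r : ℕ} {T U : Filling ℕ} {x : ℕ} {d : ℕ × ℕ} {b : Bool}
    (h : RowInsert r T x U d b) {e : ℕ × ℕ} (he : T e = none) (hne : e ≠ d) (N : ℕ) :
    RowInsert r (Function.update T e (some N)) x (Function.update U e (some N)) d b := by
  induction h with
  | place r x c T hc hn =>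
    rw [Function.update_comm hne.symm]
    exact .place _ _ _ _ (hc.update he hne N) (update_eq_none hn hne.symm)
  | bump r x c y T U d b hc hn hlt _ ih =>
    have h1 := ne_of_eq_none he hn
    refine .bump _ _ _ y _ _ _ _ (hc.update he h1 N) (by rwa [Function.update_of_ne h1.symm])
      hlt ?_
    rw [Function.update_comm h1]
    exact ih (update_eq_none he h1) hne
  | diag r x y T U d hc hn h2 =>
    have h1 := ne_of_eq_none he hn
    refine .diag _ _ y _ _ _ (hc.update he h1 N) (by rwa [Function.update_of_ne h1.symm]) ?_
    rw [Function.update_comm h1]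
    exact h2.update (update_eq_none he h1) hne N

theorem ColCell.update_self {T : Filling ℕ} {c x r N : ℕ} (h : ColCell T c x r) (hx : x < N) :
    ColCell (Function.update T (r, c) (some N)) c x r := by
  refine ⟨h.1, fun y hy => ?_, fun a h1 => ?_⟩
  · rw [Function.update_self] at hy
    cases hy
    exact hx
  · rw [Function.update_of_ne (by simp; omega)]
    exact h.2.2 a h1

theorem RowCell.update_self {T : Filling ℕ} {r x c N : ℕ} (h : RowCell T r x c) (hx : x < N) :
    RowCell (Function.update T (r, c) (some N)) r x c := by
  refine ⟨h.1, fun y hy => ?_, fun a h1 h2 => ?_⟩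
  · rw [Function.update_self] at hy
    cases hy
    exact hx
  · rw [Function.update_of_ne (by simp; omega)]
    exact h.2.2 a h1 h2

/-- If a letter `N` greater than all others occupies the cell `d` at which a column insertion ends,
then it is pushed to the end of the next column. -/
theorem ColInsert.push {c : ℕ} {T U : Filling ℕ} {x : ℕ} {d : ℕ × ℕ}
    (h : ColInsert c T x U d) {N r' : ℕ} (hU : ∀ e y, U e = some y → y < N) (hr' : r' ≤ d.2 + 1)
    (hn' : U (r', d.2 + 1) = none) (hall : ∀ e < r', U (e, d.2 + 1) ≠ none) :
    ColInsert c (Function.update T d (some N)) x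
      (Function.update U (r', d.2 + 1) (some N)) (r', d.2 + 1) := by
  induction h with
  | place c x r T hr hn =>
    have hx : x < N := hU (r, c) x (Function.update_self _ _ _)
    refine .bump _ _ r N _ _ _ (hr.update_self hx) (Function.update_self _ _ _) ?_
    rw [Function.update_idem]
    refine .place _ _ _ _ ⟨hr', ?_, ?_⟩ hn'
    · intro y hy
      simp only at hn'
      rw [hn'] at hy
      cases hy
    · intro e he
      obtain ⟨y, hy⟩ := Option.ne_none_iff_exists'.1 (hall e he)
      exact ⟨y, hy, (hU _ _ hy).le⟩
  | bump c x r y T U d hr hn h2 ih =>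
    have hd := h2.apply_eq_none
    have h1 := ne_of_eq_none (eq_none_of_update hd) hn
    refine .bump _ _ _ y _ _ _ (hr.update (eq_none_of_update hd) h1 N)
      (by rwa [Function.update_of_ne h1.symm]) ?_
    rw [Function.update_comm h1]
    exact ih hU hr' hn' hall

/-- When the old insertion ends in the column phase or on the main diagonal, the greatest letter `N`
is bumped from there into the next column, at whose end it stays. -/
theorem RowInsert.push_col {r : ℕ} {T U : Filling ℕ} {x : ℕ} {d : ℕ × ℕ} {b : Bool}
    (h : RowInsert r T x U d b) (hb : b = true ∨ d.1 = d.2) {N r' : ℕ}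
    (hU : ∀ e y, U e = some y → y < N) (hr' : r' ≤ d.2 + 1)
    (hn' : U (r', d.2 + 1) = none) (hall : ∀ e < r', U (e, d.2 + 1) ≠ none) :
    RowInsert r (Function.update T d (some N)) x
      (Function.update U (r', d.2 + 1) (some N)) (r', d.2 + 1) true := by
  induction h with
  | place r x c T hc hn =>
    obtain rfl : r = c := by simpa using hb
    -- The row phase used to end at the diagonal cell `(r, r)`. Now `N` sits there and its bumping
    -- starts the column phase.
    have hx : x < N := hU (r, r) x (Function.update_self _ _ _)
    refine .diag _ _ N _ _ _ (hc.update_self hx) (Function.update_self _ _ _) ?_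
    rw [Function.update_idem]
    refine .place _ _ _ _ ⟨hr', ?_, ?_⟩ hn'
    · intro y hy
      simp only at hn'
      rw [hn'] at hy
      cases hy
    · intro e he
      obtain ⟨y, hy⟩ := Option.ne_none_iff_exists'.1 (hall e he)
      exact ⟨y, hy, (hU _ _ hy).le⟩
  | bump r x c y T U d b hc hn hlt h2 ih =>
    have hd := h2.apply_eq_none
    have h1 := ne_of_eq_none (eq_none_of_update hd) hn
    refine .bump _ _ _ y _ _ _ _ (hc.update (eq_none_of_update hd) h1 N)
      (by rwa [Function.update_of_ne h1.symm]) hlt ?_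
    rw [Function.update_comm h1]
    exact ih hb hU hr' hn' hall
  | diag r x y T U d hc hn h2 =>
    have hd := h2.apply_eq_none
    have h1 := ne_of_eq_none (eq_none_of_update hd) hn
    refine .diag _ _ y _ _ _ (hc.update (eq_none_of_update hd) h1 N)
      (by rwa [Function.update_of_ne h1.symm]) ?_
    rw [Function.update_comm h1]
    exact h2.push hU hr' hn' hall

/-- The counterpart for an insertion that ends in the row phase off the main diagonal: `N` is bumped
to the end of the next row. -/
theorem RowInsert.push_row {r : ℕ} {T U : Filling ℕ} {x : ℕ} {d : ℕ × ℕ} {b : Bool}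
    (h : RowInsert r T x U d b) (hb : b = false) (hd' : d.1 < d.2) {N c' : ℕ}
    (hU : ∀ e y, U e = some y → y < N) (hc' : d.1 + 1 ≤ c')
    (hn' : U (d.1 + 1, c') = none) (hall : ∀ e, d.1 + 1 ≤ e → e < c' → U (d.1 + 1, e) ≠ none) :
    RowInsert r (Function.update T d (some N)) x
      (Function.update U (d.1 + 1, c') (some N)) (d.1 + 1, c') false := by
  induction h with
  | place r x c T hc hn =>
    have hx : x < N := hU (r, c) x (Function.update_self _ _ _)
    refine .bump _ _ _ N _ _ _ _ (hc.update_self hx) (Function.update_self _ _ _) hd' ?_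
    rw [Function.update_idem]
    refine .place _ _ _ _ ⟨hc', ?_, ?_⟩ hn'
    · intro y hy
      simp only at hn'
      rw [hn'] at hy
      cases hy
    · intro e he he'
      obtain ⟨y, hy⟩ := Option.ne_none_iff_exists'.1 (hall e he he')
      exact ⟨y, hy, (hU _ _ hy).le⟩
  | bump r x c y T U d b hc hn hlt h2 ih =>
    have hd := h2.apply_eq_none
    have h1 := ne_of_eq_none (eq_none_of_update hd) hn
    refine .bump _ _ _ y _ _ _ _ (hc.update (eq_none_of_update hd) h1 N)
      (by rwa [Function.update_of_ne h1.symm]) hlt ?_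
    rw [Function.update_comm h1]
    exact ih hb hd' hU hc' hn' hall
  | diag r x y T U d hc hn h2 => cases hb

/-! ### The local rule -/

theorem isFirstRowAddable_iff {lam : YoungDiagram} {M : ℕ × ℕ} :
    IsFirstRowAddable lam M ↔ M = (0, lam.rowLen 0) := by
  constructor
  · rintro ⟨h1, h2⟩
    have := h1.snd_eq
    rw [h2] at this
    exact Prod.ext h2 this
  · rintro rfl
    exact ⟨isAddable_rowLen_iff.2 (by simp), rfl⟩

/-- The cell just below `m` is not in `mu`: it cannot precede `m` in `lam`, and being the transpose
of `m` would force both `m.1 + 1 = m.2` and `m.2 = m.1`. -/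
theorem SymCover.rowLen_next_le {lam mu : YoungDiagram} {m : ℕ × ℕ} (h : SymCover lam mu m) :
    mu.rowLen (m.1 + 1) ≤ m.2 := by
  rw [← not_lt, ← YoungDiagram.mem_iff_lt_rowLen, h.mem_iff]
  rintro (h3 | h3 | h3)
  · exact h.notMem (lam.up_left_mem (Nat.le_succ _) le_rfl h3)
  · have := congrArg Prod.fst h3
    simp at this
  · have h4 := congrArg Prod.fst h3
    have h5 := congrArg Prod.snd h3
    simp only [Prod.fst_swap, Prod.snd_swap] at h4 h5
    omega

/-- Row `m.1` now contains `m`, so the row after it is strictly shorter. Hence the nearest addable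
cell of rule 3 always lies in the next row. -/
theorem SymCover.isAddable_next {lam mu : YoungDiagram} {m : ℕ × ℕ} (h : SymCover lam mu m) :
    IsAddable mu (m.1 + 1, mu.rowLen (m.1 + 1)) := by
  rw [isAddable_rowLen_iff]
  intro r hr
  have h1 := mu.rowLen_anti r m.1 (by omega)
  have h2 : m.2 < mu.rowLen m.1 := YoungDiagram.mem_iff_lt_rowLen.1 h.mem
  have h3 := h.rowLen_next_le
  omega

theorem SymCover.isNextAddable_iff {lam mu : YoungDiagram} {m M : ℕ × ℕ}
    (h : SymCover lam mu m) :
    IsNextAddable mu m M ↔ M = (m.1 + 1, mu.rowLen (m.1 + 1)) := by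
  constructor
  · rintro ⟨h1, h2, h3⟩
    have h4 := h3 _ h.isAddable_next (Nat.lt_succ_self _)
    have h5 : M.1 = m.1 + 1 := by
      simp only at h4
      omega
    have h6 := h1.snd_eq
    rw [h5] at h6
    exact Prod.ext h5 h6
  · rintro rfl
    exact ⟨h.isAddable_next, Nat.lt_succ_self _, fun c _ hc => hc⟩

theorem mem_of_mem_act {i k : ℕ} {A : Finset ℕ} (h : Raises i A) (hk : k ∈ act i A)
    (hk' : k ∉ A) : k = i := by
  rcases i with _ | j
  · by_contra h0
    simp [act, Finset.mem_symmDiff, h0, hk'] at hk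
  · rw [mem_act_succ, Equiv.swap_apply_def] at hk
    split_ifs at hk with h1 h2
    · exact absurd hk h.1
    · exact h2
    · exact absurd hk hk'

/-- The index is recovered as the only element that a raising reflection adds to `A`. -/
theorem raises_unique {i i' : ℕ} {A : Finset ℕ} (h : Raises i A) (h' : act i A = act i' A) :
    i = i' := by
  have h1 : Raises i' A := by
    by_contra hn
    have h2 := weight_act_of_not_raises hn
    rw [← h', weight_act_of_raises h] at h2
    omega
  refine mem_of_mem_act h1 ?_ h.1
  rw [← h']
  rcases i with _ | j
  · simp [act, Finset.mem_symmDiff, h.1]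
  · rw [mem_act_succ, Equiv.swap_apply_right]
    exact h.2 j rfl

theorem SymCover.eq_natAbs {lam mu : YoungDiagram} {m : ℕ × ℕ} (h : SymCover lam mu m) {i : ℕ}
    (hi : Acts (simpleC i) lam mu) : i = ((m.2 : ℤ) - m.1).natAbs := by
  obtain ⟨A, hA⟩ := exists_southSteps_eq h.symm
  refine (raises_unique (h.raises hA) (halfSet_injective ?_)).symm
  rw [← simpleC_image_halfSet, ← simpleC_image_halfSet, ← hA, ← hi, ← h.acts]

theorem Acts.unique {g : Equiv.Perm ℤ} {lam mu mu' : YoungDiagram} (h : Acts g lam mu)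
    (h' : Acts g lam mu') : mu = mu' :=
  southSteps_injective (h.trans h'.symm)

theorem IsAddable.eq_of_diag_eq {lam : YoungDiagram} {m e : ℕ × ℕ} (hm : IsAddable lam m)
    (he : IsAddable lam e) (h : (m.2 : ℤ) - m.1 = (e.2 : ℤ) - e.1) : m = e := by
  obtain ⟨m1, m2⟩ := m
  obtain ⟨e1, e2⟩ := e
  simp only at h
  rcases lt_or_ge m1 e1 with hlt | hge
  · exact absurd ((isAddable_iff.1 he).2 (m1, m2) ⟨hlt.le, by simp only; omega⟩
      fun e => hlt.ne (congrArg Prod.fst e)) (isAddable_iff.1 hm).1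
  · rcases hge.eq_or_lt with rfl | hlt
    · ext
      · rfl
      · simp only; omega
    · exact absurd ((isAddable_iff.1 hm).2 (e1, e2) ⟨hlt.le, by simp only; omega⟩
        fun e => hlt.ne (congrArg Prod.fst e)) (isAddable_iff.1 he).1

/-! ### Squares with three distinct corners. -/

section Square

variable {z y x : YoungDiagram} {m e : ℕ × ℕ}

theorem SymCover.notMem_of_ne (hy : SymCover z y m) (hx : SymCover z x e) (hxy : x ≠ y) :
    m ∉ x :=
  fun h => hxy ((hx.of_mem hy.notMem h).unique hy)

theorem SymCover.addable_of_ne (hy : SymCover z y m) (hx : SymCover z x e) (hxy : x ≠ y) :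
    IsAddable x m := by
  refine isAddable_iff.2 ⟨hy.notMem_of_ne hx hxy, fun d hd hne => ?_⟩
  exact (hx.mem_iff d).2 (Or.inl ((isAddable_iff.1 hy.addable).2 d hd hne))

/-- Two addable diagonals are neither equal nor adjacent, since each has a south step just before it
and an east step on it. Therefore the transpositions at the diagonal of `m` and at those of `e` and
its transpose have disjoint supports. -/
theorem SymCover.commute (hy : SymCover z y m) (hx : SymCover z x e) (hxy : x ≠ y) :
    simpleA ((m.2 : ℤ) - m.1) * simpleC ((e.2 : ℤ) - e.1).natAbs =
      simpleC ((e.2 : ℤ) - e.1).natAbs * simpleA ((m.2 : ℤ) - m.1) := by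
  wlog he : e.1 ≤ e.2 generalizing e
  · have := this hx.swap (by simp only [Prod.fst_swap, Prod.snd_swap]; omega)
    have hn : ((e.1 : ℤ) - e.2).natAbs = ((e.2 : ℤ) - e.1).natAbs := by omega
    rwa [Prod.fst_swap, Prod.snd_swap, hn] at this
  obtain ⟨h1, h2⟩ := hx.addable.mem_southSteps
  obtain ⟨h3, h4⟩ := hx.swap.addable.mem_southSteps
  obtain ⟨h5, h6⟩ := hy.addable.mem_southSteps
  have h7 : (m.2 : ℤ) - m.1 ≠ (e.2 : ℤ) - e.1 := fun h =>
    hy.notMem_of_ne hx hxy (hy.addable.eq_of_diag_eq hx.addable h ▸ hx.mem)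
  have h8 : (m.2 : ℤ) - m.1 ≠ (e.1 : ℤ) - e.2 := fun h =>
    hy.notMem_of_ne hx hxy (hy.addable.eq_of_diag_eq hx.swap.addable h ▸ hx.swap.mem)
  simp only [Prod.fst_swap, Prod.snd_swap] at h3 h4
  have h9 : (e.1 : ℤ) - e.2 = -((e.2 : ℤ) - e.1) := by ring
  rw [h9] at h3 h4 h8
  have hi : (((e.2 : ℤ) - e.1).natAbs : ℤ) = (e.2 : ℤ) - e.1 := by omega
  generalize ((e.2 : ℤ) - e.1).natAbs = i at hi
  rw [← hi] at h1 h2 h3 h4 h7 h8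
  generalize (m.2 : ℤ) - m.1 = j at h5 h6 h7 h8
  have n1 : j - 1 ≠ i := fun h => h2 (h ▸ h5)
  have n2 : j - 1 ≠ -i := fun h => h4 (h ▸ h5)
  have n3 : j ≠ (i : ℤ) - 1 := fun h => h6 (h ▸ h1)
  have n4 : j ≠ -(i : ℤ) - 1 := fun h => h6 (h ▸ h3)
  refine Equiv.Perm.Disjoint.commute fun d => ?_
  by_cases hd : d = j - 1 ∨ d = j
  · right
    rw [simpleC]
    split_ifs with h0
    · rw [simpleA, Equiv.swap_apply_of_ne_of_ne] <;> omega
    · rw [Equiv.Perm.mul_apply, simpleA, simpleA,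
        Equiv.swap_apply_of_ne_of_ne (a := -(i : ℤ) - 1), Equiv.swap_apply_of_ne_of_ne] <;> omega
  · left
    rw [simpleA, Equiv.swap_apply_of_ne_of_ne] <;> omega

/-- By commutation, `s_i` carries `z ∪ {m}` to `x ∪ {m}`, which forces `M = m`; and `s_i y` is `y`
with the pair of `e` added. -/
theorem offDiagonal_iff (hy : SymCover z y m) (hx : SymCover z x e) (hxy : x ≠ y)
    {w : YoungDiagram} {M : ℕ × ℕ} :
    OffDiagonal z y x w m M ↔ SymCover x w m ∧ SymCover y w e ∧ M = m := by
  obtain ⟨w', hw⟩ := exists_symCover hx.isSymm_right (hy.addable_of_ne hx hxy)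
  have hw' : SymCover y w' e := by
    refine ⟨hy.isSymm_right, hx.addable_of_ne hy hxy.symm, fun d => ?_⟩
    rw [hw.mem_iff, hx.mem_iff, hy.mem_iff]
    tauto
  obtain ⟨zm, hzm⟩ := hy.addable
  obtain ⟨xm, hxm⟩ := hw.addable
  have hact : Acts (simpleC ((e.2 : ℤ) - e.1).natAbs) zm xm := by
    have h1 := hzm.acts
    have h2 := hxm.acts
    have h3 := hx.acts
    rw [Acts] at h1 h2 h3 ⊢
    rw [h1, h2, h3, ← Set.image_comp, ← Set.image_comp, ← Equiv.Perm.coe_mul,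
      ← Equiv.Perm.coe_mul, hy.commute hx hxy]
  constructor
  · rintro ⟨i, h1, h2, zm', xM, h3, h4, h5⟩
    obtain rfl := hx.eq_natAbs h1
    obtain rfl := h2.unique hw'.acts
    obtain rfl : zm' = zm := YoungDiagram.ext (h3.2.trans hzm.2.symm)
    obtain rfl := h5.unique hact
    refine ⟨hw, hw', ?_⟩
    have : M ∈ xM.cells := by
      rw [h4.2]
      exact Finset.mem_insert_self _ _
    rw [hxm.2, Finset.mem_insert] at this
    exact this.resolve_right h4.1
  · rintro ⟨h1, h2, rfl⟩
    obtain rfl := h1.unique hw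
    exact ⟨_, hx.acts, hw'.acts, zm, xm, hzm, hxm, hact⟩

end Square

/-- The explicit outcomes of the local rule. -/
inductive LocalCase (c : Prop) (z y x w : YoungDiagram) (m M : ℕ × ℕ) : Prop
  | const : ¬ c → z = x → z = y → w = z → LocalCase c z y x w m M
  | start : c → z = x → z = y → SymCover x w M → M = (0, x.rowLen 0) → LocalCase c z y x w m M
  | bump : ¬ c → SymCover z y m → x = y → SymCover x w M → M = (m.1 + 1, x.rowLen (m.1 + 1)) →
      LocalCase c z y x w m M
  | vert (e : ℕ × ℕ) : ¬ c → z = y → SymCover z x e → w = x → LocalCase c z y x w m M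
  | horiz : ¬ c → z = x → SymCover z y m → w = y → M = m → LocalCase c z y x w m M
  | diamond (e : ℕ × ℕ) : ¬ c → SymCover z y m → SymCover z x e → x ≠ y → SymCover x w m →
      SymCover y w e → M = m → LocalCase c z y x w m M

theorem localRule_iff {c : Prop} {z y x w : YoungDiagram} {m M : ℕ × ℕ}
    (hy : z = y ∨ SymCover z y m) (hx : z = x ∨ ∃ e, SymCover z x e) (hc : c → z = x ∧ z = y) :
    LocalRule c z y x w m M ↔ LocalCase c z y x w m M := by
  constructor
  · rintro ⟨h1, h2, h3, h4, h5, h6⟩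
    by_cases hcc : c
    · obtain ⟨e1, e2⟩ := hc hcc
      obtain ⟨h7, h8⟩ := h2 e1 e2 hcc
      exact .start hcc e1 e2 (upDown_iff.1 h7) (isFirstRowAddable_iff.1 h8)
    · rcases hy with hy | hy <;> rcases hx with hx | ⟨e, hx⟩
      · exact .const hcc hx hy (h1 hx hy hcc)
      · exact .vert e hcc hy hx (h4 hy hx.ne)
      · obtain ⟨h7, h8⟩ := h5 hx hy.ne
        exact .horiz hcc hx hy h7 h8
      · by_cases hxy : x = y
        · obtain ⟨h7, h8⟩ := h3 hx.ne hxy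
          refine .bump hcc hy hxy (upDown_iff.1 h7) ?_
          subst hxy
          exact hy.isNextAddable_iff.1 h8
        · obtain ⟨h7, h8, h9⟩ := (offDiagonal_iff hy hx hxy).1 (h6 hx.ne hy.ne hxy)
          exact .diamond e hcc hy hx hxy h7 h8 h9
  · rintro (⟨h1, h2, h3, h4⟩ | ⟨h1, h2, h3, h4, h5⟩ | ⟨h1, h2, h3, h4, h5⟩ | ⟨e, h1, h2, h3, h4⟩ |
      ⟨h1, h2, h3, h4, h5⟩ | ⟨e, h1, h2, h3, h4, h5, h6, h7⟩)
    · subst h2 h3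
      simp [LocalRule, h1, h4]
    · subst h2 h3
      simp [LocalRule, h1, upDown_iff, isFirstRowAddable_iff, h4, ← h5]
    · subst h3
      have := h2.ne
      simp [LocalRule, this, upDown_iff, h2.isNextAddable_iff, h4, ← h5]
    · subst h2
      have := h3.ne
      simp [LocalRule, this, this.symm, h4]
    · subst h2
      have := h3.ne
      simp [LocalRule, this, h4, h5]
    · have := h2.ne
      have := h3.ne
      simp [LocalRule, *, offDiagonal_iff h2 h3 h4]

theorem exists_localCase {c : Prop} {z y x : YoungDiagram} {m : ℕ × ℕ} (hz : IsSymm z)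
    (hy : z = y ∨ SymCover z y m) (hx : z = x ∨ ∃ e, SymCover z x e) (hc : c → z = x ∧ z = y) :
    ∃ w M, LocalCase c z y x w m M := by
  by_cases hcc : c
  · obtain ⟨e1, e2⟩ := hc hcc
    subst e1 e2
    obtain ⟨w, hw⟩ := exists_symCover hz (isFirstRowAddable_iff.2 rfl).1
    exact ⟨w, _, .start hcc rfl rfl hw rfl⟩
  · rcases hy with hy | hy <;> rcases hx with hx | ⟨e, hx⟩
    · exact ⟨z, 0, .const hcc hx hy rfl⟩
    · exact ⟨x, 0, .vert e hcc hy hx rfl⟩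
    · exact ⟨y, m, .horiz hcc hx hy rfl rfl⟩
    · by_cases hxy : x = y
      · subst hxy
        obtain ⟨w, hw⟩ := exists_symCover hy.isSymm_right hy.isAddable_next
        exact ⟨w, _, .bump hcc hy rfl hw rfl⟩
      · obtain ⟨w, hw⟩ := exists_symCover hx.isSymm_right (hy.addable_of_ne hx hxy)
        refine ⟨w, m, .diamond e hcc hy hx hxy hw ?_ rfl⟩
        refine ⟨hy.isSymm_right, hx.addable_of_ne hy (Ne.symm hxy), fun d => ?_⟩
        rw [hw.mem_iff, hx.mem_iff, hy.mem_iff]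
        tauto

/-- The markings on top need to agree only if that edge is a cover, and the conclusion has the same
form for the bottom edge, so the statement can be iterated down the diagram. -/
theorem LocalCase.unique {c : Prop} {z y x w w' : YoungDiagram} {m m' M M' : ℕ × ℕ}
    (h : LocalCase c z y x w m M) (h' : LocalCase c z y x w' m' M') (hm : z ≠ y → m = m') :
    w = w' ∧ (x ≠ w → M = M') := by
  rcases h with ⟨h1, h2, h3, h4⟩ | ⟨h1, h2, h3, h4, h5⟩ | ⟨h1, h2, h3, h4, h5⟩ |
      ⟨e, h1, h2, h3, h4⟩ | ⟨h1, h2, h3, h4, h5⟩ | ⟨e, h1, h2, h3, h4, h5, h6, h7⟩ <;>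
    rcases h' with ⟨h1', h2', h3', h4'⟩ | ⟨h1', h2', h3', h4', h5'⟩ |
      ⟨h1', h2', h3', h4', h5'⟩ | ⟨e', h1', h2', h3', h4'⟩ | ⟨h1', h2', h3', h4', h5'⟩ |
      ⟨e', h1', h2', h3', h4', h5', h6', h7'⟩ <;>
    -- Mixed pairs of cases contradict each other; the six pairs of equal cases remain.
    first
    | exact absurd ‹c› ‹¬ c›
    | exact absurd ‹z = x› (SymCover.ne ‹SymCover z x _›)
    | exact absurd ‹z = y› (SymCover.ne ‹SymCover z y _›)
    | exact absurd ‹x = y› ‹x ≠ y›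
    | exact absurd (‹z = x›.trans ‹x = y›) (SymCover.ne ‹SymCover z y _›)
    | exact absurd (‹z = y›.trans ‹x = y›.symm) (SymCover.ne ‹SymCover z x _›)
    | skip
  · exact ⟨h4.trans h4'.symm, fun h => absurd (h2.symm.trans h4.symm) h⟩
  · subst h5 h5'
    exact ⟨h4.unique h4', fun _ => rfl⟩
  · obtain rfl := hm h2.ne
    subst h5 h5'
    exact ⟨h4.unique h4', fun _ => rfl⟩
  · exact ⟨h4.trans h4'.symm, fun h => absurd h4.symm h⟩
  · exact ⟨h4.trans h4'.symm, fun _ => by rw [h5, h5', hm h3.ne]⟩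
  · obtain rfl := hm h2.ne
    exact ⟨h5.unique h5', fun _ => h7.trans h7'.symm⟩

theorem LocalCase.horizontal {c : Prop} {z y x w : YoungDiagram} {m M : ℕ × ℕ}
    (h : LocalCase c z y x w m M) : ((z ≠ y ∨ c) ∧ SymCover x w M) ∨ ((z = y ∧ ¬ c) ∧ x = w) := by
  rcases h with ⟨h1, h2, h3, h4⟩ | ⟨h1, h2, h3, h4, h5⟩ | ⟨h1, h2, h3, h4, h5⟩ |
      ⟨e, h1, h2, h3, h4⟩ | ⟨h1, h2, h3, h4, h5⟩ | ⟨e, h1, h2, h3, h4, h5, h6, h7⟩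
  · exact Or.inr ⟨⟨h3, h1⟩, h2.symm.trans h4.symm⟩
  · exact Or.inl ⟨Or.inr h1, h4⟩
  · exact Or.inl ⟨Or.inl h2.ne, h4⟩
  · exact Or.inr ⟨⟨h2, h1⟩, h4.symm⟩
  · subst h2 h4 h5
    exact Or.inl ⟨Or.inl h3.ne, h3⟩
  · subst h7
    exact Or.inl ⟨Or.inl h2.ne, h5⟩

theorem LocalCase.vertical {c : Prop} {z y x w : YoungDiagram} {m M : ℕ × ℕ}
    (h : LocalCase c z y x w m M) :
    ((z ≠ x ∨ c) ∧ ∃ e, SymCover y w e) ∨ ((z = x ∧ ¬ c) ∧ y = w) := by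
  rcases h with ⟨h1, h2, h3, h4⟩ | ⟨h1, h2, h3, h4, h5⟩ | ⟨h1, h2, h3, h4, h5⟩ |
      ⟨e, h1, h2, h3, h4⟩ | ⟨h1, h2, h3, h4, h5⟩ | ⟨e, h1, h2, h3, h4, h5, h6, h7⟩
  · exact Or.inr ⟨⟨h2, h1⟩, h3.symm.trans h4.symm⟩
  · exact Or.inl ⟨Or.inr h1, M, h3 ▸ h2 ▸ h4⟩
  · subst h3
    exact Or.inl ⟨Or.inl h2.ne, M, h4⟩
  · subst h2 h4
    exact Or.inl ⟨Or.inl h3.ne, e, h3⟩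
  · exact Or.inr ⟨⟨h2, h1⟩, h4.symm⟩
  · exact Or.inl ⟨Or.inl h3.ne, e, h6⟩

/-! ### Growth diagrams -/

/-- A growth diagram of a `0`-`1` matrix, given by its nonzero positions. The second component is
the marking of the horizontal edge that ends here. -/
noncomputable def growth (c : ℕ → ℕ → Prop) : ℕ → ℕ → YoungDiagram × (ℕ × ℕ)
  | 0, _ => (⊥, 0)
  | _ + 1, 0 => (⊥, 0)
  | i + 1, j + 1 => Classical.epsilon fun p : YoungDiagram × (ℕ × ℕ) =>
      LocalRule (c i j) (growth c i j).1 (growth c i (j + 1)).1 (growth c (i + 1) j).1 p.1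
        (growth c i (j + 1)).2 p.2

/-- A matrix with at most one nonzero entry in each row and each column. -/
structure IsPartialPerm (c : ℕ → ℕ → Prop) : Prop where
  row : ∀ {i j j'}, c i j → c i j' → j = j'
  col : ∀ {i i' j}, c i j → c i' j → i = i'

variable {c : ℕ → ℕ → Prop}

theorem isSymm_bot : IsSymm ⊥ := fun d => by simp

theorem growth_zero_left (j : ℕ) : growth c 0 j = (⊥, 0) := by
  rw [growth]

theorem growth_zero_right (i : ℕ) : growth c i 0 = (⊥, 0) := by
  cases i <;> rw [growth]

/-- A horizontal edge is a cover if there is a nonzero entry above it, and degenerate otherwise. -/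
def GoodH (c : ℕ → ℕ → Prop) (i j : ℕ) : Prop :=
  ((∃ i' < i, c i' j) ∧ SymCover (growth c i j).1 (growth c i (j + 1)).1 (growth c i (j + 1)).2) ∨
  ((¬ ∃ i' < i, c i' j) ∧ (growth c i j).1 = (growth c i (j + 1)).1)

/-- A vertical edge is a cover if there is a nonzero entry left of it, and degenerate otherwise. -/
def GoodV (c : ℕ → ℕ → Prop) (i j : ℕ) : Prop :=
  ((∃ j' < j, c i j') ∧ ∃ e, SymCover (growth c i j).1 (growth c (i + 1) j).1 e) ∨
  ((¬ ∃ j' < j, c i j') ∧ (growth c i j).1 = (growth c (i + 1) j).1)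

theorem isSymm_growth_of_goodH {i j : ℕ} (hh : ∀ j, GoodH c i j) : IsSymm (growth c i j).1 := by
  induction j with
  | zero =>
    rw [growth_zero_right]
    exact isSymm_bot
  | succ j ih =>
    rcases hh j with ⟨_, h⟩ | ⟨_, h⟩
    · exact h.isSymm_right
    · rwa [← h]

theorem exists_lt_succ_iff {p : ℕ → Prop} {i : ℕ} :
    (∃ i' < i + 1, p i') ↔ (∃ i' < i, p i') ∨ p i := by
  constructor
  · rintro ⟨i', h1, h2⟩
    rcases (Nat.lt_succ_iff.1 h1).lt_or_eq with h3 | rfl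
    · exact Or.inl ⟨i', h3, h2⟩
    · exact Or.inr h2
  · rintro (⟨i', h1, h2⟩ | h)
    · exact ⟨i', by omega, h2⟩
    · exact ⟨i, by omega, h⟩

theorem growth_square (hc : IsPartialPerm c) {i j : ℕ} (hs : IsSymm (growth c i j).1)
    (hh : GoodH c i j) (hv : GoodV c i j) :
    LocalCase (c i j) (growth c i j).1 (growth c i (j + 1)).1 (growth c (i + 1) j).1
      (growth c (i + 1) (j + 1)).1 (growth c i (j + 1)).2 (growth c (i + 1) (j + 1)).2 := by
  have hy : (growth c i j).1 = (growth c i (j + 1)).1 ∨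
      SymCover (growth c i j).1 (growth c i (j + 1)).1 (growth c i (j + 1)).2 :=
    hh.symm.imp And.right And.right
  have hx : (growth c i j).1 = (growth c (i + 1) j).1 ∨
      ∃ e, SymCover (growth c i j).1 (growth c (i + 1) j).1 e :=
    hv.symm.imp And.right And.right
  -- A nonzero entry in this square is the only one in its row and column, so both edges leaving `z`
  -- are degenerate.
  have hcc : c i j → (growth c i j).1 = (growth c (i + 1) j).1 ∧
      (growth c i j).1 = (growth c i (j + 1)).1 := by
    intro h
    refine ⟨(hv.resolve_left ?_).2, (hh.resolve_left ?_).2⟩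
    · rintro ⟨⟨j', hj, h'⟩, _⟩
      exact hj.ne (hc.row h' h)
    · rintro ⟨⟨i', hi, h'⟩, _⟩
      exact hi.ne (hc.col h' h)
  obtain ⟨w, M, hw⟩ := exists_localCase hs hy hx hcc
  rw [← localRule_iff hy hx hcc] at hw ⊢
  have := Classical.epsilon_spec (p := fun p : YoungDiagram × (ℕ × ℕ) =>
    LocalRule (c i j) (growth c i j).1 (growth c i (j + 1)).1 (growth c (i + 1) j).1 p.1
        (growth c i (j + 1)).2 p.2) ⟨(w, M), hw⟩
  rwa [growth]

theorem goodH_succ (hc : IsPartialPerm c) {i j : ℕ} (hs : IsSymm (growth c i j).1)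
    (hh : GoodH c i j) (hv : GoodV c i j) : GoodH c (i + 1) j := by
  rw [GoodH, exists_lt_succ_iff]
  have h1 : (growth c i j).1 ≠ (growth c i (j + 1)).1 ↔ ∃ i' < i, c i' j := by
    rcases hh with ⟨h1, h2⟩ | ⟨h1, h2⟩
    · exact iff_of_true h2.ne h1
    · exact iff_of_false (not_not.2 h2) h1
  rw [← h1, not_or, not_not]
  exact (growth_square hc hs hh hv).horizontal

theorem goodV_succ (hc : IsPartialPerm c) {i j : ℕ} (hs : IsSymm (growth c i j).1)
    (hh : GoodH c i j) (hv : GoodV c i j) : GoodV c i (j + 1) := by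
  rw [GoodV, exists_lt_succ_iff]
  have h1 : (growth c i j).1 ≠ (growth c (i + 1) j).1 ↔ ∃ j' < j, c i j' := by
    rcases hv with ⟨h1, e, h2⟩ | ⟨h1, h2⟩
    · exact iff_of_true h2.ne h1
    · exact iff_of_false (not_not.2 h2) h1
  rw [← h1, not_or, not_not]
  exact (growth_square hc hs hh hv).vertical

/-- The left border is degenerate, and the squares of row `i` pass the property on from left to
right. -/
theorem goodV_of_goodH (hc : IsPartialPerm c) {i : ℕ} (hh : ∀ j, GoodH c i j) (j : ℕ) :
    GoodV c i j := by
  induction j with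
  | zero => exact Or.inr ⟨by simp, by rw [growth_zero_right, growth_zero_right]⟩
  | succ j ih => exact goodV_succ hc (isSymm_growth_of_goodH hh) (hh j) ih

theorem goodH (hc : IsPartialPerm c) (i j : ℕ) : GoodH c i j := by
  induction i generalizing j with
  | zero => exact Or.inr ⟨by simp, by rw [growth_zero_left, growth_zero_left]⟩
  | succ i ih => exact goodH_succ hc (isSymm_growth_of_goodH ih) (ih j) (goodV_of_goodH hc ih j)

theorem goodV (hc : IsPartialPerm c) (i j : ℕ) : GoodV c i j := goodV_of_goodH hc (goodH hc i) j

theorem growth_localCase (hc : IsPartialPerm c) (i j : ℕ) :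
    LocalCase (c i j) (growth c i j).1 (growth c i (j + 1)).1 (growth c (i + 1) j).1
      (growth c (i + 1) (j + 1)).1 (growth c i (j + 1)).2 (growth c (i + 1) (j + 1)).2 :=
  growth_square hc (isSymm_growth_of_goodH (goodH hc i)) (goodH hc i j) (goodV hc i j)

/-- On the edges of the growth diagram, the local rule is equivalent to its explicit form. -/
theorem growth_localRule_iff (hc : IsPartialPerm c) {i j : ℕ} {w : YoungDiagram} {m M : ℕ × ℕ}
    (hm : (∃ i' < i, c i' j) → m = (growth c i (j + 1)).2) :
    LocalRule (c i j) (growth c i j).1 (growth c i (j + 1)).1 (growth c (i + 1) j).1 w m M ↔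
    LocalCase (c i j) (growth c i j).1 (growth c i (j + 1)).1 (growth c (i + 1) j).1 w m M := by
  have hh := goodH hc i j
  have hv := goodV hc i j
  refine localRule_iff ?_ (hv.symm.imp And.right And.right) ?_
  · rcases hh with ⟨h1, h2⟩ | ⟨h1, h2⟩
    · rw [hm h1]
      exact Or.inr h2
    · exact Or.inl h2
  · intro h
    refine ⟨(hv.resolve_left ?_).2, (hh.resolve_left ?_).2⟩
    · rintro ⟨⟨j', hj, h'⟩, _⟩
      exact hj.ne (hc.row h' h)
    · rintro ⟨⟨i', hi, h'⟩, _⟩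
      exact hi.ne (hc.col h' h)

/-! ### Growth diagrams and Sagan-Worley insertion -/

/-- The one of the two cells `m` and `m.swap` that is on or above the main diagonal. -/
def upper (m : ℕ × ℕ) : ℕ × ℕ := if m.1 ≤ m.2 then m else m.swap

theorem upper_le (m : ℕ × ℕ) : (upper m).1 ≤ (upper m).2 := by
  rw [upper]
  split_ifs with h
  · exact h
  · exact (not_le.1 h).le

theorem eq_upper {d m : ℕ × ℕ} (hd : d.1 ≤ d.2) (h : d = m ∨ d = m.swap) : d = upper m := by
  rw [upper]
  split_ifs with hm
  · rcases h with rfl | rfl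
    · rfl
    · exact Prod.ext (le_antisymm hd hm) (le_antisymm hm hd)
  · rcases h with rfl | rfl
    · exact absurd hd hm
    · rfl

theorem SymCover.upper {lam mu : YoungDiagram} {m : ℕ × ℕ} (h : SymCover lam mu m) :
    SymCover lam mu (upper m) := by
  rw [FoldedInsertion.upper]
  split_ifs
  · exact h
  · exact h.swap

/-! ### Chains of diagrams as shifted tableaux. -/

theorem sInf_congr_of_le {A B : Set ℕ} {n : ℕ} (hn : n ∈ A) (h : ∀ k ≤ n, k ∈ A ↔ k ∈ B) :
    sInf A = sInf B := by
  have hB : n ∈ B := (h n le_rfl).1 hn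
  apply le_antisymm
  · exact Nat.sInf_le ((h _ (Nat.sInf_le hB)).2 (Nat.sInf_mem ⟨n, hB⟩))
  · exact Nat.sInf_le ((h _ (Nat.sInf_le hn)).1 (Nat.sInf_mem ⟨n, hn⟩))

theorem sInf_eq_succ {F : ℕ → YoungDiagram} (hF : Monotone F) {i : ℕ} {d : ℕ × ℕ}
    (h : d ∉ F i) (h' : d ∈ F (i + 1)) : sInf {k | d ∈ F k} = i + 1 := by
  apply le_antisymm (Nat.sInf_le h')
  by_contra hlt
  have h1 : d ∈ F (sInf {k | d ∈ F k}) := Nat.sInf_mem (s := {k | d ∈ F k}) ⟨i + 1, h'⟩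
  exact h (hF (by omega) h1)

theorem SymCover.mem_right_iff {lam mu : YoungDiagram} {m d : ℕ × ℕ} (h : SymCover lam mu m)
    (hne : d ≠ FoldedInsertion.upper m) : d.1 ≤ d.2 ∧ d ∈ mu ↔ d.1 ≤ d.2 ∧ d ∈ lam := by
  rw [h.mem_iff]
  refine and_congr_right fun hd => ?_
  have := mt (eq_upper (m := m) hd) hne
  tauto

open Classical in
/-- The shifted tableau, up to step `i`, of a chain of diagrams. -/
noncomputable def fill (F : ℕ → YoungDiagram) (i : ℕ) : Filling ℕ := fun d =>
  if d.1 ≤ d.2 ∧ d ∈ F i then some (sInf {k | d ∈ F k}) else none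

theorem fill_ne_none {F : ℕ → YoungDiagram} {i : ℕ} {d : ℕ × ℕ} :
    fill F i d ≠ none ↔ d.1 ≤ d.2 ∧ d ∈ F i := by
  rw [fill]
  split_ifs with h <;> simp [h]

theorem fill_eq_none {F : ℕ → YoungDiagram} {i : ℕ} {d : ℕ × ℕ} (h : d ∉ F i) :
    fill F i d = none := by
  by_contra h'
  exact h (fill_ne_none.1 h').2

theorem le_of_fill_eq {F : ℕ → YoungDiagram} {i y : ℕ} {d : ℕ × ℕ} (h : fill F i d = some y) :
    y ≤ i := by
  rw [fill] at h
  split_ifs at h with h1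
  cases h
  exact Nat.sInf_le h1.2

theorem fill_congr {F F' : ℕ → YoungDiagram} {i : ℕ} (h : ∀ k ≤ i, F k = F' k) :
    fill F i = fill F' i := by
  funext d
  rw [fill, fill, ← h i le_rfl]
  split_ifs with h1
  · rw [sInf_congr_of_le (A := {k | d ∈ F k}) (B := {k | d ∈ F' k}) h1.2]
    intro k hk
    change d ∈ F k ↔ d ∈ F' k
    rw [h k hk]
  · rfl

theorem fill_succ_of_eq {F : ℕ → YoungDiagram} {i : ℕ} (h : F i = F (i + 1)) :
    fill F (i + 1) = fill F i := by
  funext d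
  rw [fill, fill, h]

theorem fill_succ {F : ℕ → YoungDiagram} (hF : Monotone F) {i : ℕ} {e : ℕ × ℕ}
    (h : SymCover (F i) (F (i + 1)) e) :
    fill F (i + 1) = Function.update (fill F i) (upper e) (some (i + 1)) := by
  funext d
  by_cases hd : d = upper e
  · subst hd
    rw [Function.update_self, fill, if_pos ⟨upper_le e, h.upper.mem⟩,
      sInf_eq_succ hF h.upper.notMem h.upper.mem]
  · rw [Function.update_of_ne hd, fill, fill]
    simp only [h.mem_right_iff hd]

open Classical in
/-- The marked shifted tableau, up to step `j`, of a chain of diagrams with markings. -/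
noncomputable def markedFill (F : ℕ → YoungDiagram) (mk : ℕ → ℕ × ℕ) (j : ℕ) :
    Filling (ℕ × Bool) := fun d =>
  if d.1 ≤ d.2 ∧ d ∈ F j then
    some (sInf {k | d ∈ F k},
      decide (d.1 < d.2 ∧ ∃ i, i + 1 = sInf {k | d ∈ F k} ∧ mk i = (d.2, d.1)))
  else none

theorem markedFill_succ {F : ℕ → YoungDiagram} (hF : Monotone F) {mk : ℕ → ℕ × ℕ} {j : ℕ}
    (h : SymCover (F j) (F (j + 1)) (mk j)) :
    markedFill F mk (j + 1) = Function.update (markedFill F mk j) (upper (mk j))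
      (some (j + 1, decide ((mk j).2 < (mk j).1))) := by
  funext d
  by_cases hd : d = upper (mk j)
  · subst hd
    rw [Function.update_self, markedFill, if_pos ⟨upper_le _, h.upper.mem⟩,
      sInf_eq_succ hF h.upper.notMem h.upper.mem]
    congr 3
    simp only [Nat.add_right_cancel_iff, exists_eq_left, eq_iff_iff]
    -- The new cell is the transpose of the marked cell exactly when the marked cell lies strictly
    -- below the main diagonal.
    rw [upper]
    split_ifs with hm
    · refine iff_of_false ?_ hm.not_gt
      rintro ⟨h1, h2⟩
      have := congrArg Prod.fst h2
      simp only at this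
      omega
    · exact iff_of_true ⟨not_le.1 hm, rfl⟩ (not_le.1 hm)
  · rw [Function.update_of_ne hd, markedFill, markedFill]
    simp only [h.mem_right_iff hd]

theorem SymCover.le {lam mu : YoungDiagram} {m : ℕ × ℕ} (h : SymCover lam mu m) : lam ≤ mu :=
  fun d hd => (h.mem_iff d).2 (Or.inl hd)

section Column

variable {c : ℕ → ℕ → Prop}

theorem monotone_growth_col (hc : IsPartialPerm c) (j : ℕ) :
    Monotone fun i => (growth c i j).1 := by
  refine monotone_nat_of_le_succ fun i => ?_
  rcases goodV hc i j with ⟨_, e, h⟩ | ⟨_, h⟩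
  · exact h.le
  · exact h.le

theorem monotone_growth_row (hc : IsPartialPerm c) (i : ℕ) :
    Monotone fun j => (growth c i j).1 := by
  refine monotone_nat_of_le_succ fun j => ?_
  rcases goodH hc i j with ⟨_, h⟩ | ⟨_, h⟩
  · exact h.le
  · exact h.le

/-- A bumping step: the greatest letter occupies the cell where the insertion ends. -/
theorem rowInsert_bump {z y w : YoungDiagram} {m M : ℕ × ℕ} (hy : SymCover z y m)
    (hw : SymCover y w M) (hM : M = (m.1 + 1, y.rowLen (m.1 + 1))) {F : ℕ → YoungDiagram}
    {i : ℕ} (hF : F i = y) {T : Filling ℕ} {r x : ℕ}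
    (h : RowInsert r T x (fill F i) (upper m) (decide (m.2 < m.1))) :
    RowInsert r (Function.update T (upper m) (some (i + 1))) x
      (Function.update (fill F i) (upper M) (some (i + 1))) (upper M) (decide (M.2 < M.1)) := by
  subst hF
  have hU : ∀ e y, fill F i e = some y → y < i + 1 := fun e y hy =>
    Nat.lt_succ_of_le (le_of_fill_eq hy)
  have hL := hy.rowLen_next_le
  have hmem : ∀ e < (F i).rowLen (m.1 + 1), (m.1 + 1, e) ∈ F i := fun e he =>
    YoungDiagram.mem_iff_lt_rowLen.2 he
  have hMn := hw.notMem
  have hMn' := hw.swap.notMem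
  subst hM
  -- Strictly above the diagonal the insertion ended in the row phase. Otherwise the cell where it
  -- ended is `m.swap`, in column `m.1`, and `N` goes to column `m.1 + 1`.
  rcases lt_or_ge m.1 m.2 with hm | hm
  · have hmL : m.1 + 1 ≤ (F i).rowLen (m.1 + 1) := by
      rw [Nat.succ_le_iff, ← YoungDiagram.mem_iff_lt_rowLen]
      exact (F i).up_left_mem hm le_rfl hy.swap.mem
    have e1 : upper m = m := if_pos hm.le
    have e2 : upper (m.1 + 1, (F i).rowLen (m.1 + 1)) = (m.1 + 1, (F i).rowLen (m.1 + 1)) :=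
      if_pos hmL
    rw [e1] at h ⊢
    rw [e2, decide_eq_false (not_lt.2 hmL)]
    exact h.push_row (decide_eq_false hm.not_gt) hm hU hmL (fill_eq_none hMn)
      fun e h1 h2 => fill_ne_none.2 ⟨h1, hmem e h2⟩
  · have e1 : upper m = m.swap := (eq_upper hm (Or.inr rfl)).symm
    have e2 : upper (m.1 + 1, (F i).rowLen (m.1 + 1)) = ((F i).rowLen (m.1 + 1), m.1 + 1) :=
      if_neg (by simp only; omega)
    rw [e1] at h ⊢
    rw [e2, decide_eq_true (by simp only; omega)]
    refine h.push_col ?_ hU (by simp only [Prod.snd_swap]; omega) (fill_eq_none hMn')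
      fun e he => fill_ne_none.2 ⟨by simp only [Prod.snd_swap]; omega, ?_⟩
    · rcases hm.eq_or_lt with h1 | h1
      · exact Or.inr h1
      · exact Or.inl (decide_eq_true h1)
    -- By symmetry the height of column `m.1 + 1` is the length of row `m.1 + 1`.
    · exact (hw.symm _).2 (hmem e he)

/-- Induction on the greatest letter admitted. Just below the nonzero entry, `i₀ + 1` exceeds all
other letters and lands at the end of the first row. Each later square adds the letter `i + 1` to
both tableaux, or to neither if its vertical edges are degenerate. -/
theorem rowInsert_growth (hc : IsPartialPerm c) {i₀ j : ℕ} (h0 : c i₀ j) {i : ℕ} (hi : i₀ < i) :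
    RowInsert 0 (fill (fun i => (growth c i j).1) i) (i₀ + 1)
      (fill (fun i => (growth c i (j + 1)).1) i) (upper (growth c i (j + 1)).2)
      (decide ((growth c i (j + 1)).2.2 < (growth c i (j + 1)).2.1)) := by
  have mono := monotone_growth_col hc
  induction i, hi using Nat.le_induction with
  | base =>
    rcases growth_localCase hc i₀ j with ⟨h1, _⟩ | ⟨_, hx, hy, hw, hM⟩ | ⟨h1, _⟩ | ⟨_, h1, _⟩ |
      ⟨h1, _⟩ | ⟨_, h1, _⟩ <;> try exact absurd h0 h1
    rw [fill_succ_of_eq (F := fun i => (growth c i j).1) hx]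
    rw [← hx] at hw hM
    have hw' := hw
    rw [hy] at hw'
    rw [fill_succ (mono (j + 1)) hw']
    -- Column `j` of the matrix has no entry above row `i₀`, so the horizontal edges there are
    -- degenerate and the two tableaux agree up to that row.
    have hfill : fill (fun i => (growth c i (j + 1)).1) i₀ =
        fill (fun i => (growth c i j).1) i₀ := by
      refine fill_congr fun k hk => ?_
      rcases goodH hc k j with ⟨⟨i', hi', h⟩, _⟩ | ⟨_, h⟩
      · have := hc.col h h0
        omega
      · exact h.symm
    have hM' := hw.notMem
    rw [hfill]
    generalize (growth c (i₀ + 1) (j + 1)).2 = M at hM hM'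
    subst hM
    rw [upper, if_pos (Nat.zero_le _), decide_eq_false (Nat.not_lt_zero _)]
    have hn := fill_eq_none (F := fun i => (growth c i j).1) (i := i₀) hM'
    refine .place _ _ _ _ ⟨Nat.zero_le _, ?_, ?_⟩ hn
    · intro y hy
      rw [hn] at hy
      cases hy
    · intro e _ he
      obtain ⟨y, hy⟩ := Option.ne_none_iff_exists'.1
        (fill_ne_none (F := fun i => (growth c i j).1) (i := i₀) (d := (0, e)).2
          ⟨Nat.zero_le _, YoungDiagram.mem_iff_lt_rowLen.2 he⟩)
      exact ⟨y, hy, (le_of_fill_eq hy).trans (Nat.le_succ _)⟩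
  | succ i hi ih =>
    have hne : (growth c i j).1 ≠ (growth c i (j + 1)).1 := by
      rcases goodH hc i j with ⟨_, h⟩ | ⟨h, _⟩
      · exact h.ne
      · exact absurd ⟨i₀, hi, h0⟩ h
    rcases growth_localCase hc i j with ⟨_, _, h1, _⟩ | ⟨h1, _⟩ | ⟨_, hy, hxy, hw, hM⟩ |
      ⟨_, _, h1, _⟩ | ⟨_, hx, hy, hw, hM⟩ | ⟨e, _, hy, hx, hxy, hw, hw', hM⟩
    · exact absurd h1 hne
    · have := hc.col h1 h0
      omega
    · rw [hxy] at hw hM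
      have hx := hy
      rw [← hxy] at hx
      rw [fill_succ (mono j) hx, fill_succ (mono (j + 1)) hw]
      exact rowInsert_bump hy hw hM rfl ih
    · exact absurd h1 hne
    · rw [fill_succ_of_eq (F := fun i => (growth c i j).1) hx,
        fill_succ_of_eq (F := fun i => (growth c i (j + 1)).1) hw.symm, hM]
      exact ih
    · rw [fill_succ (mono j) hx, fill_succ (mono (j + 1)) hw', hM]
      -- In rule 5 the letter `i + 1` does not occupy the final cell of the insertion, since that
      -- would make `x` and `y` equal.
      refine ih.update (fill_eq_none hx.upper.notMem) ?_ _
      intro he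
      exact hxy ((hx.upper.unique (he ▸ hy.upper)))

end Column

/-! ### The growth diagram of a permutation -/

section Permutation

variable {n : ℕ} (σ : Equiv.Perm (Fin n))

/-- The nonzero positions of the permutation matrix. -/
def permPos (i j : ℕ) : Prop := ∃ a b : Fin n, (a : ℕ) = i ∧ (b : ℕ) = j ∧ σ a = b

theorem permPos_coe (i j : Fin n) : permPos σ i j ↔ σ i = j := by
  constructor
  · rintro ⟨a, b, h1, h2, h3⟩
    rwa [← Fin.ext h1, ← Fin.ext h2]
  · exact fun h => ⟨i, j, rfl, rfl, h⟩

theorem isPartialPerm_permPos : IsPartialPerm (permPos σ) where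
  row := by
    rintro _ _ _ ⟨a, b, rfl, rfl, h⟩ ⟨a', b', h1, rfl, h'⟩
    obtain rfl := Fin.ext h1
    rw [← h, ← h']
  col := by
    rintro _ _ _ ⟨a, b, rfl, rfl, h⟩ ⟨a', b', rfl, h2, h'⟩
    obtain rfl := Fin.ext h2
    rw [σ.injective (h.trans h'.symm)]

theorem isGrowth_growth : IsGrowth σ (fun i j => (growth (permPos σ) i j).1)
    (fun i j => (growth (permPos σ) i (j + 1)).2) := by
  refine ⟨fun j => ?_, fun i => ?_, fun i j => ?_⟩
  · simp only [Fin.val_zero, growth_zero_left]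
  · simp only [Fin.val_zero, growth_zero_right]
  · simp only [Fin.val_castSucc, Fin.val_succ, ← permPos_coe]
    exact (growth_localRule_iff (isPartialPerm_permPos σ) fun _ => rfl).2
      (growth_localCase (isPartialPerm_permPos σ) i j)

variable {σ}

/-- Markings are compared only below a nonzero entry; elsewhere the edge is degenerate and `H` is
arbitrary. -/
theorem IsGrowth.eq_growth {G : Fin (n + 1) → Fin (n + 1) → YoungDiagram}
    {H : Fin (n + 1) → Fin n → ℕ × ℕ} (h : IsGrowth σ G H) (i : Fin (n + 1)) :
    (∀ j, G i j = (growth (permPos σ) i j).1) ∧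
    ∀ j : Fin n, (∃ i' < (i : ℕ), permPos σ i' j) → H i j = (growth (permPos σ) i (j + 1)).2 := by
  have hc := isPartialPerm_permPos σ
  induction i using Fin.induction with
  | zero =>
    refine ⟨fun j => ?_, ?_⟩
    · rw [h.1, Fin.val_zero, growth_zero_left]
    · rintro j ⟨i', hi, _⟩
      simp at hi
  | succ i ih =>
    have key : ∀ j : Fin n, G i.succ j.castSucc = (growth (permPos σ) (i + 1) j).1 →
        G i.succ j.succ = (growth (permPos σ) (i + 1) (j + 1)).1 ∧
        ((∃ i' < (i : ℕ) + 1, permPos σ i' j) →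
          H i.succ j = (growth (permPos σ) (i + 1) (j + 1)).2) := by
      intro j hj
      have h1 := h.2.2 i j
      rw [hj, ih.1, ih.1, ← permPos_coe] at h1
      have h2 := (growth_localRule_iff hc (ih.2 j)).1 h1
      -- The edge on top is a cover only if a nonzero entry lies above it, which is when the
      -- induction hypothesis controls its marking.
      have h3 := h2.unique (growth_localCase hc i j) fun hne => ih.2 j (by
        rcases goodH hc i j with ⟨h4, _⟩ | ⟨_, h4⟩
        · exact h4
        · exact absurd h4 hne)
      refine ⟨h3.1, fun h4 => h3.2 ?_⟩
      rw [h3.1]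
      rcases goodH hc (i + 1) j with ⟨_, h5⟩ | ⟨h5, _⟩
      · exact h5.ne
      · exact absurd h4 h5
    have hG : ∀ j, G i.succ j = (growth (permPos σ) (i + 1) j).1 := by
      intro j
      induction j using Fin.induction with
      | zero => rw [h.2.1, Fin.val_zero, growth_zero_right]
      | succ j ihj => exact (key j ihj).1
    exact ⟨hG, fun j => (key j (hG _)).2⟩

theorem exists_permPos_row (i : Fin n) : ∃ j < n, permPos σ i j :=
  ⟨σ i, (σ i).2, i, σ i, rfl, rfl, rfl⟩

theorem exists_permPos_col (j : Fin n) : ∃ i < n, permPos σ i j :=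
  ⟨σ⁻¹ j, (σ⁻¹ j).2, σ⁻¹ j, j, rfl, rfl, by simp⟩

theorem symCover_bottom (j : Fin n) : SymCover (growth (permPos σ) n j).1
    (growth (permPos σ) n (j + 1)).1 (growth (permPos σ) n (j + 1)).2 := by
  rcases goodH (isPartialPerm_permPos σ) n j with ⟨_, h⟩ | ⟨h, _⟩
  · exact h
  · exact absurd (exists_permPos_col j) h

theorem weakCover_right (i : Fin n) : WeakCover (growth (permPos σ) i n).1
    (growth (permPos σ) (i + 1) n).1 := by
  rcases goodV (isPartialPerm_permPos σ) i n with ⟨_, e, h⟩ | ⟨h, _⟩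
  · exact h.covers.1
  · exact absurd (exists_permPos_row i) h

theorem maps_iff {P : StrongTableau n} {Q : WeakTableau n} :
    Maps σ P Q ↔ (∀ j : Fin (n + 1), P.shape j = (growth (permPos σ) n j).1) ∧
      (∀ j : Fin n, P.mark j = (growth (permPos σ) n (j + 1)).2) ∧
      ∀ i : Fin (n + 1), Q.shape i = (growth (permPos σ) i n).1 := by
  constructor
  · rintro ⟨G, H, hG, h1, h2, h3⟩
    refine ⟨fun j => ?_, fun j => ?_, fun i => ?_⟩
    · rw [h1, (hG.eq_growth _).1, Fin.val_last]
    · rw [h2, (hG.eq_growth _).2 j (exists_permPos_col j), Fin.val_last]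
    · rw [h3, (hG.eq_growth _).1, Fin.val_last]
  · rintro ⟨h1, h2, h3⟩
    exact ⟨_, _, isGrowth_growth σ, h1, h2, h3⟩

variable (σ) in
theorem existsUnique_maps : ∃! PQ : StrongTableau n × WeakTableau n, Maps σ PQ.1 PQ.2 := by
  refine ⟨⟨⟨fun j => (growth (permPos σ) n j).1, fun j => (growth (permPos σ) n (j + 1)).2,
    by simp only [Fin.val_zero, growth_zero_right], fun k => (symCover_bottom k).upDown.1⟩,
    ⟨fun i => (growth (permPos σ) i n).1, by simp only [Fin.val_zero, growth_zero_left],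
    fun k => weakCover_right k⟩⟩, ?_, ?_⟩
  · exact maps_iff.2 ⟨fun _ => rfl, fun _ => rfl, fun _ => rfl⟩
  · rintro ⟨P, Q⟩ h
    obtain ⟨h1, h2, h3⟩ := maps_iff.1 h
    exact Prod.ext (StrongTableau.ext (funext h1) (funext h2)) (WeakTableau.ext (funext h3))

theorem exists_coe_eq_iff {p : ℕ → Prop} {k : ℕ} (hk : k ≤ n) :
    (∃ i : Fin (n + 1), (i : ℕ) = k ∧ p i) ↔ p k :=
  ⟨by rintro ⟨i, rfl, h⟩; exact h, fun h => ⟨⟨k, by omega⟩, rfl, h⟩⟩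

theorem WeakTableau.star_eq_fill {Q : WeakTableau n} {F : ℕ → YoungDiagram}
    (h : ∀ i : Fin (n + 1), Q.shape i = F i) : Q.star = fill F n := by
  funext d
  simp only [WeakTableau.star, fill, h, Fin.val_last]
  split_ifs with h1
  · rw [← sInf_congr_of_le (A := {k | d ∈ F k}) h1.2]
    exact fun k hk => (exists_coe_eq_iff (p := fun k => d ∈ F k) hk).symm
  · rfl

theorem StrongTableau.star_eq_markedFill {P : StrongTableau n} {F : ℕ → YoungDiagram}
    {mk : ℕ → ℕ × ℕ} (h : ∀ i : Fin (n + 1), P.shape i = F i)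
    (h' : ∀ i : Fin n, P.mark i = mk i) : P.star = markedFill F mk n := by
  funext d
  simp only [StrongTableau.star, markedFill, h, h', Fin.val_last]
  split_ifs with h1
  · rw [← sInf_congr_of_le (A := {k | d ∈ F k}) h1.2]
    · have hle : sInf {k | d ∈ F k} ≤ n := Nat.sInf_le h1.2
      congr 3
      refine propext (and_congr_right fun _ => ⟨?_, ?_⟩)
      · rintro ⟨i, h2, h3⟩
        exact ⟨i, h2, h3⟩
      · rintro ⟨i, h2, h3⟩
        exact ⟨⟨i, by omega⟩, h2, h3⟩
    · exact fun k hk => (exists_coe_eq_iff (p := fun k => d ∈ F k) hk).symm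
  · rfl

/-- The tableau after `k` letters is column `k` of the growth diagram. The next letter is the row
number of the entry in the next column of the matrix, a value of `σ⁻¹`, and the recording tableau is
read off the bottom row. -/
theorem Maps.saganWorley {P : StrongTableau n} {Q : WeakTableau n} (h : Maps σ P Q) :
    SaganWorley σ⁻¹ Q.star P.star := by
  obtain ⟨h1, h2, h3⟩ := maps_iff.1 h
  have hc := isPartialPerm_permPos σ
  refine ⟨fun k => fill (fun i => (growth (permPos σ) i k).1) n,
    fun k => markedFill (fun j => (growth (permPos σ) n j).1)
      (fun j => (growth (permPos σ) n (j + 1)).2) k, ?_, ?_, fun k => ?_, ?_, ?_⟩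
  · funext d
    apply fill_eq_none
    simp only [Fin.val_zero, growth_zero_right]
    exact YoungDiagram.notMem_bot d
  · funext d
    refine if_neg ?_
    simp only [Fin.val_zero, growth_zero_right]
    exact fun hd => YoungDiagram.notMem_bot d hd.2
  · refine ⟨_, _, rowInsert_growth hc (i₀ := (σ⁻¹ k : Fin n)) (j := k) ?_ (σ⁻¹ k).2, ?_⟩
    · exact (permPos_coe σ _ _).2 (by simp)
    · exact markedFill_succ (monotone_growth_row hc n) (symCover_bottom k)
  · exact (WeakTableau.star_eq_fill h3).symm
  · exact (StrongTableau.star_eq_markedFill (F := fun j => (growth (permPos σ) n j).1)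
      (mk := fun j => (growth (permPos σ) n (j + 1)).2) h1 h2).symm

end Permutation

end FoldedInsertion

theorem theoremT {n : ℕ} (σ : Equiv.Perm (Fin n)) :
    (∃! PQ : FoldedInsertion.StrongTableau n × FoldedInsertion.WeakTableau n,
      FoldedInsertion.Maps σ PQ.1 PQ.2) ∧
    ∀ (P : FoldedInsertion.StrongTableau n) (Q : FoldedInsertion.WeakTableau n),
      FoldedInsertion.Maps σ P Q →
        ∀ (T : FoldedInsertion.Filling ℕ) (R : FoldedInsertion.Filling (ℕ × Bool)),
          FoldedInsertion.SaganWorley σ⁻¹ T R ↔ (T = Q.star ∧ R = P.star) := by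
  refine ⟨FoldedInsertion.existsUnique_maps σ, fun P Q h T R => ⟨fun hs => ?_, ?_⟩⟩
  · exact hs.unique h.saganWorley
  · rintro ⟨rfl, rfl⟩
    exact h.saganWorley
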